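/- **Setting.** Let $\Omega\subset\mathbb R^d$ be bounded and measurable. Let $\pi$ be a probability measure on $\Omega$ with Lebesgue density $\rho$, and for $x\in\Omega$ let $Q(x,\cdot)$ be a probability measure on $\mathbb R^d$ with density $q(x,\cdot)$ ($\rho$ and $q$ measurable). Assume that for some $0<c<C<\infty$ $$c<\rho(y)<C,\qquad c<q(x,y)<C\qquad\text{for all }x,y\in\Omega .$$ Let $h$ be measurable and bounded on $\Omega$, and put $\mu=\pi(h)=\int h\,d\pi$. Fix the number $n$ of cores, the number $N_0$ of exploration points, the number $\ell\ge 1$ of stages, and $T_1,\dots,T_{\ell-1}\in\mathbb N$. **Algorithm.** Start with a sample $X$ of $N_0$ random points of $\Omega$. In stage $k=1,\dots,\ell$: 1. Choose a measurable partition $\Omega=\Omega_1\sqcup\dots\sqcup\Omega_n$. It may depend in any (jointly measurable) way on everything generated so far and on additional randomness; spectral clustering of a random subsample of $X$ is one example. Elements of the partition may be empty or $\pi$-null. 2. For each $i$ with $\Omega_i\neq\emptyset$ choose a starting point $X^{(i)}_1\in\Omega_i$ and run, in parallel, a Metropolis–Hastings chain $X^{(i)}_1,\dots,X^{(i)}_{T_k}$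 with proposal kernel $Q$ and target $\tilde\pi_i=\pi(\cdot\cap\Omega_i)$, with (unnormalized) density $\tilde\pi_i(x)=\rho(x)\mathbf 1_{\Omega_i}(x)$. Add all these points, with multiplicity, to $X$. After the last stage, with its partition $(\Omega_i)$, let $X_i$ be the points of $X$ in $\Omega_i$ (from all stages, with multiplicity) and $n_i=|X_i|$. Let $p_i$ be the probability densities and $\alpha_i$ the bridge functions of bridge sampling; these are fixed before the chains of the last stage run, but may depend (measurably) on everything generated up to then, including the last partition. Given that information, let $\theta^{(i)}_1,\theta^{(i)}_2,\dots$ be i.i.d. draws from $p_i$. Define $$\hat c^{(i)}=\frac{\frac1{n_i}\sum_{j=1}^{n_i}\tilde\pi_i(\theta^{(i)}_j)\,\alpha_i(\theta^{(i)}_j)}{\frac1{n_i}\sum_{x\in X_i}p_i(x)\,\alpha_i(x)},\qquad \hat w_i=\frac{\hat c^{(i)}}{\sum_{j=1}^n\hat c^{(j)}},\qquad \hat\mu_i=\frac1{T_\ell}\sum_{t=1}^{T_\ell}h(X^{(i)}_t),\qquad \hat\mu=\sum_{i=1}^n\hat w_i\,\hat\mu_i ,$$ where the $X_t^{(i)}$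 are the points of the last stage, a quotient with zero denominator is read as $0$, and so $\hat w_i=0$ if $\Omega_i=\emptyset$. As usual in bridge sampling, assume that almost surely, for every $i$ with $\pi(\Omega_i)>0$, the function $p_i\alpha_i\tilde\pi_i$ is integrable and $\int p_i\alpha_i\tilde\pi_i\,dx\ne 0$. (For the geometric bridge $\alpha_i=(p_i\tilde\pi_i)^{-1/2}$, read as $0$ where $p_i\tilde\pi_i=0$, and any $p_i$ that is positive on $\Omega_i$, such as a normal or Student density, this holds automatically.) **Theorem (Consistency).** As the chains of the last stage are continued (with $\ell$ and $T_1,\dots,T_{\ell-1}$ fixed), $$\mathbb P\Bigl[\lim_{T_\ell\to\infty}\hat\mu=\mu\Bigr]=1 .$$ -/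

import Mathlib

open MeasureTheory ProbabilityTheory Filter Topology
open scoped ENNReal

noncomputable section

namespace ParallelMCMC

/-- The ambient Euclidean space `ℝ^d`. -/
abbrev Space (d : ℕ) : Type := EuclideanSpace ℝ (Fin d)

/-- The probability measure on `Ω` with density `ρ`. -/
def targetMeasure {d : ℕ} (Ω : Set (Space d)) (ρ : Space d → ℝ) : Measure (Space d) :=
  (volume.restrict Ω).withDensity (fun x => ENNReal.ofReal (ρ x))

/-- The measure on `ℝ^d` with Lebesgue density `f`. -/
def densityMeasure {d : ℕ} (f : Space d → ℝ) : Measure (Space d) :=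
  volume.withDensity (fun x => ENNReal.ofReal (f x))

/-- The standing assumptions: the state space `Ω ⊆ ℝ^d` is bounded, the target distribution has
density `ρ` on `Ω`, each proposal distribution `Q(x, ·)`, `x ∈ Ω`, has density `q x`, and both
densities lie strictly between two positive constants on `Ω`. Proposals may fall outside `Ω`
(there the target density is zero); a proposal kernel living on `Ω` is the case `q x = 0` off `Ω`. -/
structure BoundedDensities {d : ℕ} (Ω : Set (Space d)) (ρ : Space d → ℝ)
    (q : Space d → Space d → ℝ) : Prop where
  measurableSet_space : MeasurableSet Ω
  isBounded_space : Bornology.IsBounded Ω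
  measurable_target : Measurable ρ
  measurable_proposal : Measurable (fun z : Space d × Space d => q z.1 z.2)
  isProbabilityMeasure_target : IsProbabilityMeasure (targetMeasure Ω ρ)
  proposal_nonneg : ∀ x ∈ Ω, ∀ y, 0 ≤ q x y
  isProbabilityMeasure_proposal : ∀ x ∈ Ω, IsProbabilityMeasure (densityMeasure (q x))
  bounds : ∃ c C : ℝ, 0 < c ∧ c < C ∧ (∀ y ∈ Ω, c < ρ y ∧ ρ y < C) ∧
    ∀ x ∈ Ω, ∀ y ∈ Ω, c < q x y ∧ q x y < C

/-- The Metropolis-Hastings acceptance probability of the move `x → y`, for the (possibly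
unnormalized) target density `τ` and the proposal density `q`. -/
def mhAccept {d : ℕ} (q : Space d → Space d → ℝ) (τ : Space d → ℝ) (x y : Space d) : ℝ :=
  open Classical in
  if τ x * q x y = 0 then 1 else min 1 ((τ y * q y x) / (τ x * q x y))

/-- The law of the next state of the Metropolis-Hastings chain with proposal density `q` and
(possibly unnormalized) target density `τ`, when the current state is `x`: an accepted proposal,
or else `x` itself with the remaining mass. -/
def mhStep {d : ℕ} (q : Space d → Space d → ℝ) (τ : Space d → ℝ) (x : Space d) :
    Measure (Space d) :=
  densityMeasure (fun y => q x y * mhAccept q τ x y) +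
    (1 - densityMeasure (fun y => q x y * mhAccept q τ x y) Set.univ) • Measure.dirac x

/-- The `i`-th element of the partition of `Ω` given by the labelling `lab`. -/
def cell {d n : ℕ} (Ω : Set (Space d)) (lab : Space d → Fin n) (i : Fin n) : Set (Space d) :=
  {x | x ∈ Ω ∧ lab x = i}

/-- The density of the unnormalized restriction of the target to the `i`-th element of the
partition, extended by zero. -/
def cellDensity {d n : ℕ} (Ω : Set (Space d)) (ρ : Space d → ℝ) (lab : Space d → Fin n)
    (i : Fin n) : Space d → ℝ :=
  (cell Ω lab i).indicator ρ

/-- The bridge-sampling estimate of the mass of the unnormalized density `τ`, from the sample `S`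
(counted with multiplicity) and as many draws `θ 0, θ 1, …` from the density `p`, with bridge
function `α`. -/
def bridgeEstimate {d : ℕ} (τ p α : Space d → ℝ) (S : Multiset (Space d)) (θ : ℕ → Space d) : ℝ :=
  ((1 / (S.card : ℝ)) * ∑ j ∈ Finset.range S.card, τ (θ j) * α (θ j)) /
    ((1 / (S.card : ℝ)) * (S.map (fun x => p x * α x)).sum)

/-- A run of the parallel MCMC algorithm with `n` cores, `N₀` exploration points, `ℓ` stages
(numbered `1, …, ℓ`) and chain lengths `T 1, …, T (ℓ - 1)`, realized on a probability space `(Ξ, P)`.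
The chains are continued indefinitely; how many of their points are used is decided by the
functions `sample`, `weight` and `estimate` below. In particular one run carries the output of the
algorithm for all values of the length of the last stage at once.

The partitions are those found by the clustering step. Nothing is required of them beyond
measurability, so that the (randomized) spectral clustering of the sample collected so far is one
possibility. -/
structure Run {d : ℕ} (Ω : Set (Space d)) (ρ : Space d → ℝ) (q : Space d → Space d → ℝ)
    (n N₀ ℓ : ℕ) (T : ℕ → ℕ) {Ξ : Type*} [mΞ : MeasurableSpace Ξ] (P : Measure Ξ) where
  /-- The information available in stage `k` when the chains of that stage are about to start:
  everything generated before, the partition of stage `k` and the initial points. -/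
  info : ℕ → MeasurableSpace Ξ
  info_le : ∀ k, info k ≤ mΞ
  info_mono : Monotone info
  /-- The points obtained by exploring the state space. -/
  explore : Fin N₀ → Ξ → Space d
  measurable_explore : ∀ j, Measurable[info 1] (explore j)
  explore_mem : ∀ j, ∀ᵐ ω ∂P, explore j ω ∈ Ω
  /-- The partition of stage `k`: `label k ω x` is the index of the element that contains `x`. -/
  label : ℕ → Ξ → Space d → Fin n
  measurable_label : ∀ k, 1 ≤ k → k ≤ ℓ →
    Measurable[(info k).prod inferInstance] (fun z : Ξ × Space d => label k z.1 z.2)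
  /-- `chain k i t` is the `(t + 1)`-st point of the `i`-th chain of stage `k`. It is meaningful
  only where the `i`-th element of the partition is not empty. -/
  chain : ℕ → Fin n → ℕ → Ξ → Space d
  measurable_chain : ∀ k i t, Measurable (chain k i t)
  measurable_chain_zero : ∀ k i, 1 ≤ k → k ≤ ℓ → Measurable[info k] (chain k i 0)
  measurable_chain_past : ∀ k k' i t, 1 ≤ k → k < k' → k' ≤ ℓ → t < T k →
    Measurable[info k'] (chain k i t)
  chain_zero_mem : ∀ k i, 1 ≤ k → k ≤ ℓ → ∀ᵐ ω ∂P,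
    (cell Ω (label k ω) i).Nonempty → chain k i 0 ω ∈ cell Ω (label k ω) i
  /-- Given the past, the `i`-th chain makes a Metropolis-Hastings step whose target is the
  restriction of the target distribution to the `i`-th element of the current partition. -/
  chain_step : ∀ k i t, 1 ≤ k → k ≤ ℓ → ∀ A : Set (Space d), MeasurableSet A → ∀ᵐ ω ∂P,
    (cell Ω (label k ω) i).Nonempty →
      (P⟦chain k i (t + 1) ⁻¹' A | info k ⊔ ⨆ (j : Fin n) (s : ℕ) (_ : s ≤ t),
        MeasurableSpace.comap (chain k j s) inferInstance⟧) ω =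
      (mhStep q (cellDensity Ω ρ (label k ω) i) (chain k i t ω)).real A
  /-- The proposal densities of bridge sampling, fixed before the chains of the last stage run. -/
  bridgeProposal : Fin n → Ξ → Space d → ℝ
  measurable_bridgeProposal : ∀ i,
    Measurable[(info ℓ).prod inferInstance] (fun z : Ξ × Space d => bridgeProposal i z.1 z.2)
  bridgeProposal_nonneg : ∀ i ω x, 0 ≤ bridgeProposal i ω x
  isProbabilityMeasure_bridgeProposal :
    ∀ i ω, IsProbabilityMeasure (densityMeasure (bridgeProposal i ω))
  /-- The bridge functions, fixed before the chains of the last stage run. -/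
  bridgeFunction : Fin n → Ξ → Space d → ℝ
  measurable_bridgeFunction : ∀ i,
    Measurable[(info ℓ).prod inferInstance] (fun z : Ξ × Space d => bridgeFunction i z.1 z.2)
  /-- The draws from the proposal densities of bridge sampling. -/
  draw : Fin n → ℕ → Ξ → Space d
  measurable_draw : ∀ i j, Measurable (draw i j)
  /-- The draws with index `i` are i.i.d. from the `i`-th proposal density, given the
  information that determines this density. -/
  draw_law : ∀ i j, ∀ A : Set (Space d), MeasurableSet A → ∀ᵐ ω ∂P,
    (P⟦draw i j ⁻¹' A | info ℓ ⊔ ⨆ (s : ℕ) (_ : s < j),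
        MeasurableSpace.comap (draw i s) inferInstance⟧) ω =
      (densityMeasure (bridgeProposal i ω)).real A

namespace Run

variable {d : ℕ} {Ω : Set (Space d)} {ρ : Space d → ℝ} {q : Space d → Space d → ℝ}
  {n N₀ ℓ : ℕ} {T : ℕ → ℕ} {Ξ : Type*} [MeasurableSpace Ξ] {P : Measure Ξ}

/-- The points produced in stage `k` when its chains have length `t`, with multiplicity. No chain
is run in an empty element of the partition. -/
def stagePoints (R : Run Ω ρ q n N₀ ℓ T P) (k t : ℕ) (ω : Ξ) : Multiset (Space d) :=
  open Classical in
  ∑ i : Fin n, if (cell Ω (R.label k ω) i).Nonempty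
    then (Multiset.range t).map (fun s => R.chain k i s ω) else 0

/-- All the points collected up to the end of stage `k`, with multiplicity, when the chain lengths
are `T' 1, T' 2, …`. -/
def sample (R : Run Ω ρ q n N₀ ℓ T P) (T' : ℕ → ℕ) : ℕ → Ξ → Multiset (Space d)
  | 0, ω => (Finset.univ : Finset (Fin N₀)).val.map (fun j => R.explore j ω)
  | k + 1, ω => R.sample T' k ω + R.stagePoints (k + 1) (T' (k + 1)) ω

/-- The collected points that lie in the `i`-th element of the last partition. -/
def cellSample (R : Run Ω ρ q n N₀ ℓ T P) (T' : ℕ → ℕ) (i : Fin n) (ω : Ξ) :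
    Multiset (Space d) :=
  open Classical in
  (R.sample T' ℓ ω).filter (fun x => x ∈ cell Ω (R.label ℓ ω) i)

/-- The bridge-sampling estimate of the mass of the `i`-th element of the last partition. -/
def rawWeight (R : Run Ω ρ q n N₀ ℓ T P) (T' : ℕ → ℕ) (i : Fin n) (ω : Ξ) : ℝ :=
  bridgeEstimate (cellDensity Ω ρ (R.label ℓ ω) i) (R.bridgeProposal i ω) (R.bridgeFunction i ω)
    (R.cellSample T' i ω) (fun j => R.draw i j ω)

/-- The renormalized weights. -/
def weight (R : Run Ω ρ q n N₀ ℓ T P) (T' : ℕ → ℕ) (i : Fin n) (ω : Ξ) : ℝ :=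
  R.rawWeight T' i ω / ∑ j : Fin n, R.rawWeight T' j ω

/-- The average of `h` along the `i`-th chain of the last stage. -/
def chainMean (R : Run Ω ρ q n N₀ ℓ T P) (h : Space d → ℝ) (T' : ℕ → ℕ) (i : Fin n) (ω : Ξ) : ℝ :=
  (1 / (T' ℓ : ℝ)) * ∑ t ∈ Finset.range (T' ℓ), h (R.chain ℓ i t ω)

/-- The estimate returned by the algorithm. -/
def estimate (R : Run Ω ρ q n N₀ ℓ T P) (h : Space d → ℝ) (T' : ℕ → ℕ) (ω : Ξ) : ℝ :=
  ∑ i : Fin n, R.chainMean h T' i ω * R.weight T' i ω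

end Run

end ParallelMCMC

end

/-! Freeze the past of the last stage: the partition and the bridge densities and functions are then
fixed, and only finitely many earlier points are present. In a cell of mass `m i > 0` the chain
obeys the law of large numbers from any starting point. Its averages of `h` tend to `(m i)⁻¹` times
the integral of `h` over the cell, and those of `p α` to `(m i)⁻¹ * I`, where `I` is the integral of
`p α` times the cell density. The draws give `I` in the numerator, so the bridge estimate tends to
`m i`. The draws almost surely miss a null cell, whose estimate is therefore exactly `0`. Since the
masses add up to `1`, the weights tend to the `m i`, and the estimate to the sum of the integrals of
`h` over the cells.

The law of large numbers is `ae_tendsto_average`, for a kernel that depends on a random parameter,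
has an invariant law for each parameter and is minorized uniformly in the state. The parameter is
carried along in the state (`liftKernel`), so that a mixture of invariant laws is stationary. Let
`B` be the event that the sums of a centred `F` exceed infinitely often a line of slope above `r >
0`. It is shift invariant, so its probability is a bounded harmonic function of the state, and by
minorization it depends on the parameter only (`harmonic_eq_of_minorized`). The maximal ergodic
theorem gives `r * P B ≤ ∫_B F (x 0) dP`, and the right side vanishes because `F` is centred for
each parameter. Hence `B` is null for the stationary chain, and then for every starting point.

For Metropolis–Hastings, the accepted flow from `x` to `y` is `min (ρ x * q x y) (ρ y * q y x)`:
symmetric, which gives invariance (`lintegral_mhStep`), and at least `c * c`, which gives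
minorization (`exists_minorization`). Each chain and each sequence of draws is treated separately;
their joint law plays no role, since finitely many almost sure limits combine. -/

noncomputable section

namespace ParallelMCMC

/-! ### The maximal ergodic theorem. -/

section MaximalErgodic

variable {α : Type*}

/-- The running maximum of `0` and the first `n` Birkhoff sums. -/
def birkhoffMax (T : α → α) (f : α → ℝ) : ℕ → α → ℝ
  | 0, _ => 0
  | n + 1, x => max 0 (f x + birkhoffMax T f n (T x))

lemma birkhoffMax_nonneg (T : α → α) (f : α → ℝ) (n : ℕ) (x : α) : 0 ≤ birkhoffMax T f n x := by
  cases n with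
  | zero => exact le_rfl
  | succ n => exact le_max_left _ _

lemma birkhoffMax_le_succ (T : α → α) (f : α → ℝ) (n : ℕ) (x : α) :
    birkhoffMax T f n x ≤ birkhoffMax T f (n + 1) x := by
  induction n generalizing x with
  | zero => exact birkhoffMax_nonneg _ _ _ _
  | succ n ih => exact max_le_max le_rfl (add_le_add le_rfl (ih _))

lemma birkhoffSum_le_birkhoffMax (T : α → α) (f : α → ℝ) (n : ℕ) (x : α) :
    birkhoffSum T f n x ≤ birkhoffMax T f n x := by
  induction n generalizing x with
  | zero => simp [birkhoffMax]
  | succ n ih =>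
    rw [birkhoffSum_succ']
    exact (add_le_add le_rfl (ih _)).trans (le_max_right _ _)

variable [MeasurableSpace α] {μ : Measure α}

lemma measurable_birkhoffMax {T : α → α} (hT : Measurable T) {f : α → ℝ} (hf : Measurable f)
    (n : ℕ) : Measurable (birkhoffMax T f n) := by
  induction n with
  | zero => exact measurable_const
  | succ n ih => exact measurable_const.max (hf.add (ih.comp hT))

lemma integrable_birkhoffMax {T : α → α} (hT : MeasurePreserving T μ μ) {f : α → ℝ}
    (hf : Integrable f μ) (n : ℕ) : Integrable (birkhoffMax T f n) μ := by
  induction n with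
  | zero => exact integrable_zero _ _ _
  | succ n ih =>
    exact (integrable_zero α ℝ μ).sup (hf.add (hT.integrable_comp_of_integrable ih))

/-- The maximal ergodic theorem, on the set where a running maximum is positive. -/
lemma setIntegral_birkhoffMax_pos_nonneg {T : α → α} (hT : MeasurePreserving T μ μ) {f : α → ℝ}
    (hfm : Measurable f) (hf : Integrable f μ) (n : ℕ) :
    0 ≤ ∫ x in {x | 0 < birkhoffMax T f (n + 1) x}, f x ∂μ := by
  set M := birkhoffMax T f (n + 1) with hM
  have hMi : Integrable M μ := integrable_birkhoffMax hT hf _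
  have hMm : Measurable M := measurable_birkhoffMax hT.measurable hfm _
  have hMTi : Integrable (fun x => M (T x)) μ := hT.integrable_comp_of_integrable hMi
  have hS : MeasurableSet {x | 0 < M x} := measurableSet_lt measurable_const hMm
  have h0 : ∫ x, M (T x) ∂μ = ∫ x, M x ∂μ := by
    conv_rhs => rw [← hT.map_eq]
    rw [integral_map hT.measurable.aemeasurable (hMm.aestronglyMeasurable)]
  -- Garsia's argument: where `M > 0`, `f x` is `M x` minus the previous maximum at `T x`, hence at
  -- least `M x - M (T x)`; elsewhere `M x = 0` and `M (T x) ≥ 0`. The coboundary `M - M ∘ T`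
  -- integrates to zero.
  have h1 : 0 ≤ ∫ x, ({x | 0 < M x}.indicator f x - (M x - M (T x))) ∂μ := by
    refine integral_nonneg fun x => ?_
    have hnn : 0 ≤ M (T x) := birkhoffMax_nonneg _ _ _ _
    have hnx : 0 ≤ M x := birkhoffMax_nonneg _ _ _ _
    by_cases hx : 0 < M x
    · have : M x = f x + birkhoffMax T f n (T x) := by
        have h2 : M x = max 0 (f x + birkhoffMax T f n (T x)) := rfl
        rcases max_choice (0 : ℝ) (f x + birkhoffMax T f n (T x)) with h3 | h3 <;> linarith
      have h4 := birkhoffMax_le_succ T f n (T x)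
      simp only [Pi.zero_apply, Set.indicator_of_mem (show x ∈ {x | 0 < M x} from hx)]
      linarith
    · simp only [Pi.zero_apply, Set.indicator_of_notMem (show x ∉ {x | 0 < M x} from hx)]
      linarith
  have hd : Integrable (fun x => M x - M (T x)) μ := hMi.sub hMTi
  rw [integral_sub (hf.indicator hS) hd, integral_indicator hS,
    integral_sub hMi hMTi, h0] at h1
  linarith

/-- The maximal ergodic theorem. -/
theorem integral_nonneg_of_exists_birkhoffSum_pos {T : α → α} (hT : MeasurePreserving T μ μ)
    {f : α → ℝ} (hfm : Measurable f) (hf : Integrable f μ)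
    (hpos : ∀ x, f x ≠ 0 → ∃ n, 0 < birkhoffSum T f n x) : 0 ≤ ∫ x, f x ∂μ := by
  have hmono : Monotone fun n => {x | 0 < birkhoffMax T f (n + 1) x} :=
    monotone_nat_of_le_succ fun n x hx => lt_of_lt_of_le hx (birkhoffMax_le_succ _ _ _ _)
  have hlim := tendsto_setIntegral_of_monotone (μ := μ) (f := f)
    (fun n => measurableSet_lt measurable_const (measurable_birkhoffMax hT.measurable hfm (n + 1)))
    hmono hf.integrableOn
  -- The union contains every point where `f` does not vanish, so restricting to it loses nothing.
  have hunion : ∫ x in ⋃ n, {x | 0 < birkhoffMax T f (n + 1) x}, f x ∂μ = ∫ x, f x ∂μ := by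
    refine setIntegral_eq_integral_of_forall_compl_eq_zero fun x hx => ?_
    by_contra hne
    obtain ⟨n, hn⟩ := hpos x hne
    refine hx (Set.mem_iUnion.2 ⟨n, ?_⟩)
    exact (hn.trans_le (birkhoffSum_le_birkhoffMax _ _ _ _)).trans_le (birkhoffMax_le_succ _ _ _ _)
  rw [hunion] at hlim
  exact ge_of_tendsto' hlim fun n => setIntegral_birkhoffMax_pos_nonneg hT hfm hf n

end MaximalErgodic

/-! ### Sequences that exceed a line infinitely often. -/

section LinearGrowth

/-- The sequence `s` exceeds infinitely often a linear function with slope larger than `r`. -/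
def ExceedsSlope (r : ℝ) (s : ℕ → ℝ) : Prop :=
  ∃ δ : ℚ, r < δ ∧ ∃ᶠ n : ℕ in atTop, (δ : ℝ) * n < s n

/-- The strict gap `r < δ` leaves room for a smaller slope `δ'`, and the linear gain `(δ - δ') * n`
absorbs both the constant `c` and the shift of the index. This is what makes the exceedance event
shift invariant. -/
lemma ExceedsSlope.of_succ {r c : ℝ} {s s' : ℕ → ℝ} (hs : ∀ n, s (n + 1) = c + s' n)
    (h : ExceedsSlope r s') : ExceedsSlope r s := by
  obtain ⟨δ, hδ, hfreq⟩ := h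
  obtain ⟨δ', h1, h2⟩ := exists_rat_btwn hδ
  refine ⟨δ', h1, ?_⟩
  have hev : ∀ᶠ n : ℕ in atTop, (δ' : ℝ) * ((n + 1 : ℕ) : ℝ) ≤ δ * n + c := by
    have : Tendsto (fun n : ℕ => ((δ : ℝ) - δ') * n) atTop atTop :=
      tendsto_natCast_atTop_atTop.const_mul_atTop (by linarith)
    filter_upwards [this.eventually_ge_atTop ((δ' : ℝ) - c)] with n hn
    push_cast
    linarith
  have hf2 : ∃ᶠ n : ℕ in atTop, (δ' : ℝ) * ((n + 1 : ℕ) : ℝ) < s (n + 1) := by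
    refine (hfreq.and_eventually hev).mono fun n hn => ?_
    rw [hs n]
    linarith [hn.1, hn.2]
  exact (tendsto_add_atTop_nat 1).frequently hf2

lemma ExceedsSlope.succ {r c : ℝ} {s s' : ℕ → ℝ} (hs : ∀ n, s (n + 1) = c + s' n)
    (h : ExceedsSlope r s) : ExceedsSlope r s' := by
  obtain ⟨δ, hδ, hfreq⟩ := h
  obtain ⟨δ', h1, h2⟩ := exists_rat_btwn hδ
  refine ⟨δ', h1, ?_⟩
  have hev : ∀ᶠ n : ℕ in atTop, (δ' : ℝ) * n ≤ δ * ((n + 1 : ℕ) : ℝ) - c := by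
    have : Tendsto (fun n : ℕ => ((δ : ℝ) - δ') * n) atTop atTop :=
      tendsto_natCast_atTop_atTop.const_mul_atTop (by linarith)
    filter_upwards [this.eventually_ge_atTop (c - δ)] with n hn
    push_cast
    linarith
  have hf2 : ∃ᶠ n : ℕ in atTop, (δ : ℝ) * ((n + 1 : ℕ) : ℝ) < s (n + 1) := by
    rw [frequently_atTop] at hfreq ⊢
    intro a
    obtain ⟨b, hb, hb'⟩ := hfreq (a + 1)
    obtain ⟨k, rfl⟩ : ∃ k, b = k + 1 := ⟨b - 1, by omega⟩
    exact ⟨k, by omega, hb'⟩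
  refine (hf2.and_eventually hev).mono fun n hn => ?_
  have := hs n
  linarith [hn.1, hn.2]

/-- Only countably many slopes are tested, so that almost sure statements for each slope can be
combined. -/
lemma tendsto_average_of_not_exceedsSlope {s : ℕ → ℝ}
    (h1 : ∀ k : ℕ, ¬ ExceedsSlope (1 / (k + 1 : ℝ)) s)
    (h2 : ∀ k : ℕ, ¬ ExceedsSlope (1 / (k + 1 : ℝ)) (fun n => -s n)) :
    Tendsto (fun n : ℕ => 1 / (n : ℝ) * s n) atTop (𝓝 0) := by
  rw [Metric.tendsto_atTop']
  intro ε hε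
  obtain ⟨k, hk⟩ := exists_nat_one_div_lt hε
  obtain ⟨δ, hδ1, hδ2⟩ := exists_rat_btwn hk
  have e1 : ∀ᶠ n : ℕ in atTop, s n ≤ δ * n := by
    have := h1 k
    simp only [ExceedsSlope, not_exists, not_and, not_frequently, not_lt] at this
    exact this δ hδ1
  have e2 : ∀ᶠ n : ℕ in atTop, -s n ≤ δ * n := by
    have := h2 k
    simp only [ExceedsSlope, not_exists, not_and, not_frequently, not_lt] at this
    exact this δ hδ1
  obtain ⟨N, hN⟩ := eventually_atTop.1 (e1.and e2)
  refine ⟨N, fun n hn => ?_⟩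
  have hn0 : (0 : ℝ) < n := by exact_mod_cast (Nat.zero_le N).trans_lt hn
  obtain ⟨h3, h4⟩ := hN n hn.le
  rw [Real.dist_eq, sub_zero, abs_mul, abs_of_pos (by positivity : (0 : ℝ) < 1 / n),
    one_div_mul_eq_div, div_lt_iff₀ hn0]
  calc |s n| ≤ δ * n := abs_le.2 ⟨by linarith, h3⟩
    _ < ε * n := by gcongr

end LinearGrowth

/-! ### Path laws of Markov chains and the shift. -/

section MarkovProcess

variable {Z Ξ Ξ' : Type*} [MeasurableSpace Z] [MeasurableSpace Ξ] [MeasurableSpace Ξ']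

/-- The process `X` is, under `μ`, a time-homogeneous Markov chain with transition kernel `κ`. -/
def IsMarkovProcess (κ : Kernel Z Z) (μ : Measure Ξ) (X : ℕ → Ξ → Z) : Prop :=
  ∀ (n : ℕ) (A : ℕ → Set Z), (∀ i, MeasurableSet (A i)) →
    (μ.restrict {ω | ∀ i ≤ n, X i ω ∈ A i}).map (X (n + 1)) =
      ((μ.restrict {ω | ∀ i ≤ n, X i ω ∈ A i}).map (X n)).bind κ

lemma measurableSet_box {X : ℕ → Ξ → Z} (hX : ∀ n, Measurable (X n)) {A : ℕ → Set Z}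
    (hA : ∀ i, MeasurableSet (A i)) (n : ℕ) : MeasurableSet {ω | ∀ i ≤ n, X i ω ∈ A i} := by
  have : {ω | ∀ i ≤ n, X i ω ∈ A i} = ⋂ i, ⋂ (_ : i ≤ n), X i ⁻¹' A i := by
    ext ω; simp
  rw [this]
  exact MeasurableSet.iInter fun i => MeasurableSet.iInter fun _ => hX i (hA i)

omit [MeasurableSpace Z] [MeasurableSpace Ξ] in
lemma box_zero (X : ℕ → Ξ → Z) (A : ℕ → Set Z) :
    {ω | ∀ i ≤ 0, X i ω ∈ A i} = X 0 ⁻¹' A 0 := by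
  ext ω; simp

omit [MeasurableSpace Z] [MeasurableSpace Ξ] in
lemma box_succ (X : ℕ → Ξ → Z) (A : ℕ → Set Z) (n : ℕ) :
    {ω | ∀ i ≤ n + 1, X i ω ∈ A i} = X (n + 1) ⁻¹' A (n + 1) ∩ {ω | ∀ i ≤ n, X i ω ∈ A i} := by
  ext ω
  simp only [Set.mem_ofPred_eq, Set.mem_inter_iff, Set.mem_preimage]
  refine ⟨fun h => ⟨h _ le_rfl, fun i hi => h i (by omega)⟩, fun h i hi => ?_⟩
  rcases Nat.lt_or_ge n i with h1 | h1
  · obtain rfl : i = n + 1 := by omega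
    exact h.1
  · exact h.2 i h1

/-- Integrating out the last coordinate shortens the box by one step; iterated, this expresses all
finite-dimensional laws through the initial law and `κ`. -/
lemma IsMarkovProcess.setLIntegral_box_succ {κ : Kernel Z Z} {μ : Measure Ξ} {X : ℕ → Ξ → Z}
    (hM : IsMarkovProcess κ μ X) (hX : ∀ n, Measurable (X n)) {A : ℕ → Set Z}
    (hA : ∀ i, MeasurableSet (A i)) {g : Z → ℝ≥0∞} (hg : Measurable g) (n : ℕ) :
    ∫⁻ ω in {ω | ∀ i ≤ n + 1, X i ω ∈ A i}, g (X (n + 1) ω) ∂μ =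
      ∫⁻ ω in {ω | ∀ i ≤ n, X i ω ∈ A i},
        (∫⁻ z, (A (n + 1)).indicator g z ∂κ (X n ω)) ∂μ := by
  rw [box_succ, ← Measure.restrict_restrict (hX _ (hA _)),
    ← setLIntegral_map (hA _) hg (hX _), hM n A hA, ← lintegral_indicator (hA _),
    Measure.lintegral_bind κ.measurable.aemeasurable (hg.indicator (hA _)).aemeasurable,
    lintegral_map _ (hX n)]
  exact (hg.indicator (hA _)).lintegral_kernel

/-- The test function is arbitrary because the induction step replaces `g` by the `κ`-integral of
its restriction to the last side of the box. -/
lemma IsMarkovProcess.setLIntegral_box_eq {κ : Kernel Z Z} {μ : Measure Ξ} {X : ℕ → Ξ → Z}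
    {μ' : Measure Ξ'} {X' : ℕ → Ξ' → Z}
    (hM : IsMarkovProcess κ μ X) (hX : ∀ n, Measurable (X n))
    (hM' : IsMarkovProcess κ μ' X') (hX' : ∀ n, Measurable (X' n))
    (h0 : μ.map (X 0) = μ'.map (X' 0)) {A : ℕ → Set Z}
    (hA : ∀ i, MeasurableSet (A i)) (n : ℕ) {g : Z → ℝ≥0∞} (hg : Measurable g) :
    ∫⁻ ω in {ω | ∀ i ≤ n, X i ω ∈ A i}, g (X n ω) ∂μ =
      ∫⁻ ω in {ω | ∀ i ≤ n, X' i ω ∈ A i}, g (X' n ω) ∂μ' := by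
  induction n generalizing g with
  | zero =>
    rw [box_zero, box_zero, ← setLIntegral_map (hA _) hg (hX _), ← setLIntegral_map (hA _) hg (hX' _), h0]
  | succ n ih =>
    rw [hM.setLIntegral_box_succ hX hA hg, hM'.setLIntegral_box_succ hX' hA hg]
    exact ih (hg.indicator (hA _)).lintegral_kernel

/-- The law of a Markov chain is determined by the initial law and the transition kernel. -/
theorem IsMarkovProcess.map_eq {κ : Kernel Z Z} {μ : Measure Ξ} [IsFiniteMeasure μ]
    {X : ℕ → Ξ → Z} {μ' : Measure Ξ'} {X' : ℕ → Ξ' → Z}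
    (hM : IsMarkovProcess κ μ X) (hX : ∀ n, Measurable (X n))
    (hM' : IsMarkovProcess κ μ' X') (hX' : ∀ n, Measurable (X' n))
    (h0 : μ.map (X 0) = μ'.map (X' 0)) :
    μ.map (fun ω n => X n ω) = μ'.map (fun ω n => X' n ω) := by
  have hX2 : Measurable (fun ω n => X n ω) := measurable_pi_lambda _ hX
  have hX2' : Measurable (fun ω n => X' n ω) := measurable_pi_lambda _ hX'
  have key : ∀ (A : ℕ → Set Z), (∀ i, MeasurableSet (A i)) → ∀ n,
      μ.map (fun ω n => X n ω) {x | ∀ i ≤ n, x i ∈ A i} =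
        μ'.map (fun ω n => X' n ω) {x | ∀ i ≤ n, x i ∈ A i} := by
    intro A hA n
    have hbox : MeasurableSet {x : ℕ → Z | ∀ i ≤ n, x i ∈ A i} :=
      measurableSet_box (X := fun i (x : ℕ → Z) => x i) (fun i => measurable_pi_apply i) hA n
    rw [Measure.map_apply hX2 hbox, Measure.map_apply hX2' hbox]
    have := hM.setLIntegral_box_eq hX hM' hX' h0 hA n (g := fun _ => 1) measurable_const
    simpa using this
  refine ext_of_generate_finite _ (generateFrom_squareCylinders (α := fun _ : ℕ => Z)).symm
    (isPiSystem_squareCylinders (fun _ => MeasurableSpace.isPiSystem_measurableSet)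
      (fun _ => MeasurableSet.univ)) ?_ ?_
  · intro s hs
    obtain ⟨I, S, hS, rfl⟩ := hs
    have hS' : ∀ i, MeasurableSet (S i) := fun i => hS i (Set.mem_univ i)
    -- A cylinder over the finite set `I` is a box up to `max I` whose sides outside `I` are the
    -- whole space.
    have := key (fun i => if i ∈ I then S i else Set.univ)
      (fun i => by by_cases h : i ∈ I <;> simp [h, hS' i]) (I.sup id)
    convert this using 2 <;>
    · ext x
      simp only [Set.mem_pi, Set.mem_ofPred_eq]
      constructor
      · intro h i _
        by_cases hi : i ∈ I
        · simpa [hi] using h i hi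
        · simp [hi]
      · intro h i hi
        have := h i (Finset.le_sup (f := id) hi)
        have hi' : i ∈ I := hi
        simpa [hi'] using this
  · have := key (fun _ => Set.univ) (fun _ => MeasurableSet.univ) 0
    simpa using this

/-- The law of the Markov chain with transition kernel `κ`, as a function of the initial state. -/
def pathKernel (κ : Kernel Z Z) [IsMarkovKernel κ] : Kernel Z (ℕ → Z) :=
  (Kernel.traj (X := fun _ => Z)
    (fun n => κ.comap (fun x : (Finset.Iic n → Z) => x ⟨n, Finset.mem_Iic.2 le_rfl⟩)
      (measurable_pi_apply _)) 0).comap (fun z _ => z) (by fun_prop)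

instance (κ : Kernel Z Z) [IsMarkovKernel κ] : IsMarkovKernel (pathKernel κ) := by
  unfold pathKernel; infer_instance

lemma pathKernel_map_zero (κ : Kernel Z Z) [IsMarkovKernel κ] (z : Z) :
    (pathKernel κ z).map (fun x => x 0) = Measure.dirac z := by
  have h1 : (fun x : ℕ → Z => x 0) =
      (fun y : (Finset.Iic 0 → Z) => y ⟨0, Finset.mem_Iic.2 le_rfl⟩) ∘
        (Preorder.frestrictLe (π := fun _ : ℕ => Z) 0) := rfl
  rw [h1, ← Measure.map_map (by fun_prop) (by fun_prop), pathKernel, Kernel.comap_apply,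
    Kernel.traj_map_frestrictLe_apply, Kernel.partialTraj_self, Kernel.id_apply]
  exact Measure.map_dirac' (measurable_pi_apply _) _

lemma isMarkovProcess_pathKernel (κ : Kernel Z Z) [IsMarkovKernel κ] (z : Z) :
    IsMarkovProcess κ (pathKernel κ z) (fun n x => x n) := by
  intro n A hA
  set C' : Set (Finset.Iic n → Z) := {y | ∀ i, y i ∈ A i.1} with hC'
  have hC'm : MeasurableSet C' := by
    have : C' = ⋂ i : Finset.Iic n, (fun y => y i) ⁻¹' A i.1 := by ext y; simp [hC']
    rw [this]
    exact MeasurableSet.iInter fun i => measurable_pi_apply i (hA i.1)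
  have hC : {x : ℕ → Z | ∀ i ≤ n, x i ∈ A i} =
      (Preorder.frestrictLe (π := fun _ : ℕ => Z) n) ⁻¹' C' := by
    ext x; simp [hC']
  have hCm : MeasurableSet {x : ℕ → Z | ∀ i ≤ n, x i ∈ A i} :=
    measurableSet_box (X := fun i (x : ℕ → Z) => x i) (fun i => measurable_pi_apply i) hA n
  ext D hD
  rw [Measure.map_apply (measurable_pi_apply _) hD,
    Measure.restrict_apply (measurable_pi_apply _ hD),
    Measure.bind_apply hD κ.measurable.aemeasurable,
    lintegral_map (κ.measurable_coe hD) (measurable_pi_apply _)]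
  set η : (n : ℕ) → Kernel (Finset.Iic n → Z) Z := fun n =>
    κ.comap (fun x : (Finset.Iic n → Z) => x ⟨n, Finset.mem_Iic.2 le_rfl⟩)
      (measurable_pi_apply _) with hη
  -- The Ionescu-Tulcea construction: the law of the coordinates up to `n` followed by a step of `κ`
  -- is the law of the coordinates up to `n + 1`. Evaluating on `C' ×ˢ D` gives the Markov property.
  have h := Kernel.partialTraj_compProd_eq_map_traj (X := fun _ => Z) (κ := η) (Nat.zero_le n)
    (x₀ := fun _ => z)
  have h2 := congrArg (fun m => m (C' ×ˢ D)) h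
  rw [Measure.compProd_apply_prod hC'm hD, Measure.map_apply (by fun_prop) (hC'm.prod hD),
    ← Kernel.traj_map_frestrictLe_apply, setLIntegral_map hC'm ((η n).measurable_coe hD)
      (by fun_prop), ← hC] at h2
  rw [Set.inter_comm]
  refine Eq.trans (congrArg (pathKernel κ z) ?_) h2.symm
  exact congrArg (· ∩ (fun x : ℕ → Z => x (n + 1)) ⁻¹' D) hC

lemma isMarkovProcess_bind_pathKernel (κ : Kernel Z Z) [IsMarkovKernel κ] (μ : Measure Z) :
    IsMarkovProcess κ (μ.bind (pathKernel κ)) (fun n x => x n) := by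
  intro n A hA
  have hCm : MeasurableSet {x : ℕ → Z | ∀ i ≤ n, x i ∈ A i} :=
    measurableSet_box (X := fun i (x : ℕ → Z) => x i) (fun i => measurable_pi_apply i) hA n
  ext D hD
  rw [Measure.map_apply (measurable_pi_apply _) hD,
    Measure.restrict_apply (measurable_pi_apply _ hD),
    Measure.bind_apply hD κ.measurable.aemeasurable,
    lintegral_map (κ.measurable_coe hD) (measurable_pi_apply _),
    Measure.bind_apply ((measurable_pi_apply _ hD).inter hCm) (Kernel.measurable _).aemeasurable,
    ← lintegral_indicator hCm, Measure.lintegral_bind (Kernel.measurable _).aemeasurable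
      (Measurable.indicator (f := fun x : ℕ → Z => κ (x n) D)
        ((κ.measurable_coe hD).comp (measurable_pi_apply n)) hCm).aemeasurable]
  congr 1 with z
  have := congrArg (fun m => m D) (isMarkovProcess_pathKernel κ z n A hA)
  rw [Measure.map_apply (measurable_pi_apply _) hD,
    Measure.restrict_apply (measurable_pi_apply _ hD),
    Measure.bind_apply hD κ.measurable.aemeasurable,
    lintegral_map (κ.measurable_coe hD) (measurable_pi_apply _)] at this
  rw [lintegral_indicator hCm]
  exact this

lemma map_zero_bind_pathKernel (κ : Kernel Z Z) [IsMarkovKernel κ] (μ : Measure Z) :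
    (μ.bind (pathKernel κ)).map (fun x => x 0) = μ := by
  ext D hD
  rw [Measure.map_apply (measurable_pi_apply _) hD, Measure.bind_apply (measurable_pi_apply _ hD)
    (Kernel.measurable _).aemeasurable]
  have (z : Z) : pathKernel κ z ((fun x => x 0) ⁻¹' D) = D.indicator 1 z := by
    rw [← Measure.map_apply (measurable_pi_apply _) hD, pathKernel_map_zero,
      Measure.dirac_apply' _ hD]
  simp_rw [this]
  exact lintegral_indicator_one hD

/-- The path law of a Markov chain is a mixture of the path laws of chains with a fixed start. -/
lemma IsMarkovProcess.map_eq_bind {κ : Kernel Z Z} [IsMarkovKernel κ] {μ : Measure Ξ}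
    [IsFiniteMeasure μ] {X : ℕ → Ξ → Z} (hM : IsMarkovProcess κ μ X)
    (hX : ∀ n, Measurable (X n)) :
    μ.map (fun ω n => X n ω) = (μ.map (X 0)).bind (pathKernel κ) := by
  have := hM.map_eq hX (isMarkovProcess_bind_pathKernel κ (μ.map (X 0)))
    (fun n => measurable_pi_apply n) (map_zero_bind_pathKernel κ _).symm
  simpa using this

lemma IsMarkovProcess.succ {κ : Kernel Z Z} {μ : Measure Ξ} {X : ℕ → Ξ → Z}
    (hM : IsMarkovProcess κ μ X) : IsMarkovProcess κ μ (fun n => X (n + 1)) := by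
  intro n A hA
  have := hM (n + 1) (fun i => match i with | 0 => Set.univ | i + 1 => A i)
    (fun i => by cases i with | zero => exact MeasurableSet.univ | succ i => exact hA i)
  have e : {ω | ∀ i ≤ n, X (i + 1) ω ∈ A i} = {ω | ∀ i ≤ n + 1, X i ω ∈
      (match i with | 0 => Set.univ | i + 1 => A i : Set Z)} := by
    ext ω
    constructor
    · intro h i hi
      cases i with
      | zero => exact Set.mem_univ _
      | succ i => exact h i (by omega)
    · intro h i hi
      exact h (i + 1) (by omega)
  rw [e]
  exact this

/-- The shift of the path space. -/
def pathShift (x : ℕ → Z) : ℕ → Z := fun n => x (n + 1)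

lemma measurable_pathShift : Measurable (pathShift : (ℕ → Z) → ℕ → Z) :=
  measurable_pi_lambda _ fun n => measurable_pi_apply (n + 1)

/-- The shifted process is again a Markov chain for `κ`, now started from `μ.bind κ`, and the
initial law determines the path law. -/
lemma bind_pathKernel_map_pathShift (κ : Kernel Z Z) [IsMarkovKernel κ] (μ : Measure Z)
    [IsFiniteMeasure μ] :
    (μ.bind (pathKernel κ)).map pathShift = (μ.bind κ).bind (pathKernel κ) := by
  have hM := isMarkovProcess_bind_pathKernel κ μ
  have h1 := hM.succ.map_eq_bind (fun n => measurable_pi_apply (n + 1))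
  have h2 := hM 0 (fun _ => Set.univ) (fun _ => MeasurableSet.univ)
  simp only [Set.mem_univ, implies_true, Set.ofPred_true, Measure.restrict_univ] at h2
  rw [map_zero_bind_pathKernel] at h2
  rw [← h2]
  exact h1

lemma measurePreserving_pathShift (κ : Kernel Z Z) [IsMarkovKernel κ] {μ : Measure Z}
    [IsFiniteMeasure μ] (hμ : μ.bind κ = μ) :
    MeasurePreserving pathShift (μ.bind (pathKernel κ)) (μ.bind (pathKernel κ)) :=
  ⟨measurable_pathShift, by rw [bind_pathKernel_map_pathShift, hμ]⟩

/-- The probability of an invariant event is a harmonic function of the initial state. -/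
lemma lintegral_pathKernel_invariant (κ : Kernel Z Z) [IsMarkovKernel κ] {B : Set (ℕ → Z)}
    (hB : MeasurableSet B) (hinv : pathShift ⁻¹' B = B) (z : Z) :
    ∫⁻ y, pathKernel κ y B ∂κ z = pathKernel κ z B := by
  -- Started at `z`, the shifted path is a chain started from `κ z`, while invariance of `B` makes
  -- the shift invisible.
  have h1 := bind_pathKernel_map_pathShift κ (Measure.dirac z)
  rw [Measure.dirac_bind (Kernel.measurable _), Measure.dirac_bind (Kernel.measurable _)] at h1
  rw [← Measure.bind_apply hB (Kernel.measurable _).aemeasurable, ← h1,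
    Measure.map_apply measurable_pathShift hB, hinv]

end MarkovProcess

/-! ### Law of large numbers for a minorized kernel with a random parameter. -/

section RandomKernel

variable {W E Ξ : Type*} [MeasurableSpace W] [MeasurableSpace E] [MeasurableSpace Ξ]

/-- A bounded harmonic function of a uniformly minorized transition kernel is constant. -/
lemma harmonic_eq_of_minorized {κ : E → Measure E} (hκ : ∀ x, IsProbabilityMeasure (κ x))
    {ν : Measure E} (hν : ν ≠ 0) (hle : ∀ x, ν ≤ κ x) {φ : E → ℝ} (hφ : Measurable φ)
    (h0 : ∀ x, 0 ≤ φ x) (h1 : ∀ x, φ x ≤ 1) (hharm : ∀ x, ∫ y, φ y ∂κ x = φ x) (x y : E) :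
    φ x = φ y := by
  have hνfin : IsFiniteMeasure ν := isFiniteMeasure_of_le (κ x) (hle x)
  have hne : Nonempty E := ⟨x⟩
  have hba : BddAbove (Set.range φ) := ⟨1, by rintro _ ⟨z, rfl⟩; exact h1 z⟩
  have hbb : BddBelow (Set.range φ) := ⟨0, by rintro _ ⟨z, rfl⟩; exact h0 z⟩
  set S := ⨆ z, φ z
  set I := ⨅ z, φ z
  have hS : ∀ z, φ z ≤ S := le_ciSup hba
  have hI : ∀ z, I ≤ φ z := ciInf_le hbb
  have hint (m : Measure E) [IsFiniteMeasure m] : Integrable φ m :=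
    Integrable.of_bound hφ.aestronglyMeasurable 1
      (ae_of_all _ fun z => by rw [Real.norm_eq_abs, abs_of_nonneg (h0 z)]; exact h1 z)
  have hpos : 0 < ν.real Set.univ := by
    rw [measureReal_def, ENNReal.toReal_pos_iff]
    exact ⟨pos_iff_ne_zero.2 (by simpa using hν), measure_lt_top _ _⟩
  -- Since `S - φ` is nonnegative, its `ν`-integral is at most its `κ z`-integral, which is `S - φ
  -- z` by harmonicity. Letting `φ z` approach the supremum makes the `ν`-integral nonpositive. The
  -- same for `φ - I` and addition give `(S - I) * ν univ ≤ 0`; no extremum need be attained.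
  have upper (z : E) : S * ν.real Set.univ - ∫ y, φ y ∂ν ≤ S - φ z := by
    have := hκ z
    have h := integral_mono_measure (hle z) (f := fun y => S - φ y)
      (ae_of_all _ fun y => sub_nonneg.2 (hS y)) ((integrable_const S).sub (hint _))
    rw [integral_sub (integrable_const _) (hint _), integral_sub (integrable_const _) (hint _),
      hharm] at h
    simpa [mul_comm] using h
  have lower (z : E) : ∫ y, φ y ∂ν - I * ν.real Set.univ ≤ φ z - I := by
    have := hκ z
    have h := integral_mono_measure (hle z) (f := fun y => φ y - I)
      (ae_of_all _ fun y => sub_nonneg.2 (hI y)) ((hint _).sub (integrable_const I))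
    rw [integral_sub (hint _) (integrable_const _), integral_sub (hint _) (integrable_const _),
      hharm] at h
    simpa [mul_comm] using h
  have hS' : S ≤ S - (S * ν.real Set.univ - ∫ y, φ y ∂ν) :=
    ciSup_le fun z => by linarith [upper z]
  have hI' : I + (∫ y, φ y ∂ν - I * ν.real Set.univ) ≤ I :=
    le_ciInf fun z => by linarith [lower z]
  have hSI : (S - I) * ν.real Set.univ ≤ 0 := by linarith
  have : S ≤ I := by nlinarith
  linarith [hS x, hS y, hI x, hI y]

/-- The transition kernel `κ`, which depends on a parameter, as a kernel that also carries the
parameter along. -/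
def liftKernel (κ : Kernel (W × E) E) : Kernel (W × E) (W × E) :=
  (Kernel.deterministic Prod.fst measurable_fst) ×ₖ κ

instance (κ : Kernel (W × E) E) [IsMarkovKernel κ] : IsMarkovKernel (liftKernel κ) := by
  unfold liftKernel; infer_instance

lemma liftKernel_apply (κ : Kernel (W × E) E) [IsMarkovKernel κ] (z : W × E) :
    liftKernel κ z = (κ z).map (Prod.mk z.1) := by
  rw [liftKernel, Kernel.prod_apply, Kernel.deterministic_apply, Measure.dirac_prod]

variable (κ : Kernel (W × E) E) [IsMarkovKernel κ] (π : Kernel W E) [IsMarkovKernel π]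

/-- A mixture of invariant laws is invariant for the lifted kernel. -/
lemma compProd_bind_liftKernel {μ : Measure W} [IsFiniteMeasure μ]
    (hinv : ∀ᵐ w ∂μ, ∀ A, MeasurableSet A → ∫⁻ x, κ (w, x) A ∂π w = π w A) :
    (μ ⊗ₘ π).bind (liftKernel κ) = μ ⊗ₘ π := by
  ext s hs
  rw [Measure.bind_apply hs (Kernel.measurable _).aemeasurable,
    Measure.lintegral_compProd (Kernel.measurable_coe _ hs), Measure.compProd_apply hs]
  refine lintegral_congr_ae (hinv.mono fun w hw => ?_)
  simp only
  rw [← hw _ (measurable_prodMk_left hs)]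
  refine lintegral_congr fun x => ?_
  rw [liftKernel_apply, Measure.map_apply measurable_prodMk_left hs]

/-- The probability of an invariant event depends only on the parameter, not on the initial
state. -/
lemma pathKernel_liftKernel_eq {w : W}
    (hmin : ∃ ν : Measure E, ν ≠ 0 ∧ ∀ x, ν ≤ κ (w, x)) {B : Set (ℕ → W × E)}
    (hB : MeasurableSet B) (hBinv : pathShift ⁻¹' B = B) (x y : E) :
    pathKernel (liftKernel κ) (w, x) B = pathKernel (liftKernel κ) (w, y) B := by
  obtain ⟨ν, hν, hle⟩ := hmin
  have hmeas : Measurable fun x => pathKernel (liftKernel κ) (w, x) B :=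
    (Kernel.measurable_coe _ hB).comp measurable_prodMk_left
  have h := harmonic_eq_of_minorized (κ := fun x => κ (w, x)) (fun x => inferInstance) hν hle
    (φ := fun x => (pathKernel (liftKernel κ) (w, x)).real B)
    hmeas.ennreal_toReal (fun x => measureReal_nonneg)
    (fun x => measureReal_le_one) ?_ x y
  · simpa [measureReal_def, ENNReal.toReal_eq_toReal_iff'] using h
  · intro x
    -- The lifted chain never changes `w`, so harmonicity for the lifted kernel is harmonicity in
    -- `x` for `κ (w, ·)`.
    have h2 := lintegral_pathKernel_invariant (liftKernel κ) hB hBinv (w, x)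
    rw [liftKernel_apply, lintegral_map (Kernel.measurable_coe _ hB) measurable_prodMk_left] at h2
    simp only [measureReal_def]
    rw [integral_toReal hmeas.aemeasurable (ae_of_all _ fun y => measure_lt_top _ _), h2]

variable {κ π}

/-- The event that the sums of `F` along a path exceed a linear function of slope above `r`. -/
def exceedSet {Z : Type*} (F : Z → ℝ) (r : ℝ) : Set (ℕ → Z) :=
  {x | ExceedsSlope r fun n => ∑ k ∈ Finset.range n, F (x k)}

/-- Rational slopes in `ExceedsSlope` make this a countable union. -/
lemma measurableSet_exceedSet {Z : Type*} [MeasurableSpace Z] {F : Z → ℝ} (hF : Measurable F)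
    (r : ℝ) : MeasurableSet (exceedSet F r) := by
  have hS (n : ℕ) : Measurable fun x : ℕ → Z => ∑ k ∈ Finset.range n, F (x k) :=
    Finset.measurable_sum _ fun k _ => hF.comp (measurable_pi_apply k)
  have : exceedSet F r = ⋃ (δ : ℚ) (_ : r < δ), ⋂ a : ℕ, ⋃ (n : ℕ) (_ : a ≤ n),
      {x : ℕ → Z | (δ : ℝ) * n < ∑ k ∈ Finset.range n, F (x k)} := by
    ext x
    simp [exceedSet, ExceedsSlope, frequently_atTop]
  rw [this]
  exact MeasurableSet.iUnion fun δ => MeasurableSet.iUnion fun _ => MeasurableSet.iInter fun a =>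
    MeasurableSet.iUnion fun n => MeasurableSet.iUnion fun _ =>
      measurableSet_lt measurable_const (hS n)

lemma preimage_pathShift_exceedSet {Z : Type*} (F : Z → ℝ) (r : ℝ) :
    pathShift ⁻¹' exceedSet F r = exceedSet F r := by
  ext x
  have hs (n : ℕ) : ∑ k ∈ Finset.range (n + 1), F (x k) =
      F (x 0) + ∑ k ∈ Finset.range n, F (pathShift x k) := by
    rw [Finset.sum_range_succ', add_comm]
    rfl
  exact ⟨fun h => ExceedsSlope.of_succ hs h, fun h => ExceedsSlope.succ hs h⟩

/-- By invariance the whole orbit of `x` stays in the set, so the indicator is always `1`. -/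
lemma birkhoffSum_indicator_exceedSet {Z : Type*} (F : Z → ℝ) (r : ℝ) {x : ℕ → Z}
    (hx : x ∈ exceedSet F r) (n : ℕ) :
    birkhoffSum pathShift ((exceedSet F r).indicator fun x => F (x 0) - r) n x =
      ∑ k ∈ Finset.range n, F (x k) - n * r := by
  induction n generalizing x with
  | zero => simp
  | succ n ih =>
    have hx' : pathShift x ∈ exceedSet F r := by
      rwa [← Set.mem_preimage, preimage_pathShift_exceedSet]
    rw [birkhoffSum_succ', ih hx', Set.indicator_of_mem hx, Finset.sum_range_succ']
    simp only [pathShift]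
    push_cast
    ring

/-- For a function whose mean vanishes for almost every parameter, the sums along almost every path
of the stationary chain do not exceed a linear function of positive slope. -/
lemma stationary_exceedSet_null {μ : Measure W} [IsFiniteMeasure μ]
    (hinv : ∀ᵐ w ∂μ, ∀ A, MeasurableSet A → ∫⁻ x, κ (w, x) A ∂π w = π w A)
    (hmin : ∀ᵐ w ∂μ, ∃ ν : Measure E, ν ≠ 0 ∧ ∀ x, ν ≤ κ (w, x))
    {F : W × E → ℝ} (hF : Measurable F) (hFi : Integrable F (μ ⊗ₘ π))
    (hF0 : ∀ᵐ w ∂μ, ∫ x, F (w, x) ∂π w = 0) {r : ℝ} (hr : 0 < r) :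
    (μ ⊗ₘ π).bind (pathKernel (liftKernel κ)) (exceedSet F r) = 0 := by
  set B := exceedSet F r with hBdef
  have hB : MeasurableSet B := measurableSet_exceedSet hF r
  have hBinv : pathShift ⁻¹' B = B := preimage_pathShift_exceedSet F r
  set P := (μ ⊗ₘ π).bind (pathKernel (liftKernel κ)) with hP
  have hPres : MeasurePreserving pathShift P P :=
    measurePreserving_pathShift _ (compProd_bind_liftKernel κ π hinv)
  have hF0m : Measurable fun x : ℕ → W × E => F (x 0) := hF.comp (measurable_pi_apply 0)
  have hFP : Integrable (fun x : ℕ → W × E => F (x 0)) P := by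
    rw [← map_zero_bind_pathKernel (liftKernel κ) (μ ⊗ₘ π)] at hFi
    exact hFi.comp_measurable (measurable_pi_apply 0)
  -- On `B` some sum of `F - r` is positive and off `B` the function vanishes, which is the
  -- hypothesis of the maximal ergodic theorem.
  have hnonneg : 0 ≤ ∫ x, B.indicator (fun x => F (x 0) - r) x ∂P := by
    refine integral_nonneg_of_exists_birkhoffSum_pos hPres
      ((hF0m.sub_const r).indicator hB) ((hFP.sub (integrable_const r)).indicator hB) ?_
    intro x hx
    have hxB : x ∈ B := by
      by_contra h
      exact hx (Set.indicator_of_notMem h _)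
    obtain ⟨δ, hδ, hfreq⟩ := id hxB
    obtain ⟨n, hn⟩ := hfreq.exists
    refine ⟨n, ?_⟩
    rw [birkhoffSum_indicator_exceedSet F r hxB]
    have : r * n ≤ δ * n := by gcongr
    linarith
  -- Given the initial state `z`, the integral is `F z` times the probability of `B` from `z`. That
  -- probability depends only on the parameter, and `F` has mean zero for almost every parameter.
  have hzero : ∫ x, B.indicator (fun x => F (x 0)) x ∂P = 0 := by
    have hBi : Integrable (B.indicator fun x => F (x 0)) P := hFP.indicator hB
    have hinner (z : W × E) : ∫ x, B.indicator (fun x => F (x 0)) x ∂pathKernel (liftKernel κ) z =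
        F z * (pathKernel (liftKernel κ) z).real B := by
      have hae : ∀ᵐ x ∂pathKernel (liftKernel κ) z, F (x 0) = F z := by
        have hset : MeasurableSet {y | F y = F z} := measurableSet_eq_fun hF measurable_const
        refine (ae_map_iff (f := fun x : ℕ → W × E => x 0) (measurable_pi_apply 0).aemeasurable
          hset).1 ?_
        rw [pathKernel_map_zero, ae_dirac_iff hset]
      rw [integral_indicator hB, setIntegral_congr_ae hB (hae.mono fun x hx _ => hx),
        setIntegral_const, smul_eq_mul, mul_comm]
    have hφm : Measurable fun z : W × E => (pathKernel (liftKernel κ) z).real B :=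
      (Kernel.measurable_coe _ hB).ennreal_toReal
    have hFφ : Integrable (fun z => F z * (pathKernel (liftKernel κ) z).real B) (μ ⊗ₘ π) :=
      hFi.mul_bdd (c := 1) hφm.aestronglyMeasurable (ae_of_all _ fun z => by
        rw [Real.norm_eq_abs, abs_of_nonneg measureReal_nonneg]; exact measureReal_le_one)
    rw [hP, Measure.comp_eq_comp_const_apply] at hBi ⊢
    rw [Kernel.integral_comp hBi, Kernel.const_apply]
    simp_rw [hinner]
    rw [Measure.integral_compProd hFφ]
    refine integral_eq_zero_of_ae ?_
    filter_upwards [hmin, hF0] with w hw hw0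
    obtain ⟨x₀⟩ := nonempty_of_isProbabilityMeasure (π w)
    have hc (x : E) : (pathKernel (liftKernel κ) (w, x)).real B =
        (pathKernel (liftKernel κ) (w, x₀)).real B := by
      rw [measureReal_def, pathKernel_liftKernel_eq κ hw hB hBinv x x₀, measureReal_def]
    simp_rw [hc]
    rw [integral_mul_const, hw0, zero_mul, Pi.zero_apply]
  have hsplit : ∫ x, B.indicator (fun x => F (x 0) - r) x ∂P = - (r * P.real B) := by
    rw [integral_indicator hB] at hzero ⊢
    rw [integral_sub hFP.integrableOn (integrable_const r).integrableOn, hzero]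
    simp [mul_comm]
  rw [hsplit] at hnonneg
  have h0 : P.real B = 0 := by
    have : 0 ≤ P.real B := measureReal_nonneg
    nlinarith
  exact (measureReal_eq_zero_iff).1 h0

/-- Whatever the initial state, the sums along the path of a chain whose transition kernel depends
on a parameter do not exceed a linear function of positive slope. -/
lemma ae_notMem_exceedSet {μ : Measure Ξ} [IsFiniteMeasure μ] {ι : Ξ → W} (hι : Measurable ι)
    {X : ℕ → Ξ → E} (hX : ∀ n, Measurable (X n))
    (hM : IsMarkovProcess (liftKernel κ) μ fun n ω => (ι ω, X n ω))
    (hinv : ∀ᵐ w ∂μ.map ι, ∀ A, MeasurableSet A → ∫⁻ x, κ (w, x) A ∂π w = π w A)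
    (hmin : ∀ᵐ w ∂μ.map ι, ∃ ν : Measure E, ν ≠ 0 ∧ ∀ x, ν ≤ κ (w, x))
    {F : W × E → ℝ} (hF : Measurable F) (hFi : Integrable F (μ.map ι ⊗ₘ π))
    (hF0 : ∀ᵐ w ∂μ.map ι, ∫ x, F (w, x) ∂π w = 0) {r : ℝ} (hr : 0 < r) :
    ∀ᵐ ω ∂μ, ¬ ExceedsSlope r fun n => ∑ k ∈ Finset.range n, F (ι ω, X k ω) := by
  have hB : MeasurableSet (exceedSet F r) := measurableSet_exceedSet hF r
  have hBinv := preimage_pathShift_exceedSet F r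
  have h0 := stationary_exceedSet_null hinv hmin hF hFi hF0 hr
  have hZ (n : ℕ) : Measurable fun ω => (ι ω, X n ω) := hι.prodMk (hX n)
  have hZ' : Measurable fun ω (n : ℕ) => (ι ω, X n ω) := measurable_pi_lambda _ hZ
  -- Stationary nullity gives one good starting point for almost every parameter; independence of
  -- the starting point extends it to all, so the actual initial law is irrelevant.
  have hnull : ∀ᵐ w ∂μ.map ι, ∀ x, pathKernel (liftKernel κ) (w, x) (exceedSet F r) = 0 := by
    rw [Measure.bind_apply hB (Kernel.measurable _).aemeasurable,
      lintegral_eq_zero_iff (Kernel.measurable_coe _ hB)] at h0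
    filter_upwards [hmin, Measure.ae_ae_of_ae_compProd h0] with w hw hw0 x
    obtain ⟨y, hy⟩ := hw0.exists
    rw [pathKernel_liftKernel_eq κ hw hB hBinv x y]
    exact hy
  have hlaw := hM.map_eq_bind hZ
  have hμ : μ.map (fun ω n => (ι ω, X n ω)) (exceedSet F r) = 0 := by
    rw [hlaw, Measure.bind_apply hB (Kernel.measurable _).aemeasurable,
      lintegral_map (Kernel.measurable_coe _ hB) (hZ 0)]
    refine (lintegral_congr_ae ((ae_of_ae_map hι.aemeasurable hnull).mono fun ω hω => ?_)).trans
      lintegral_zero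
    exact hω _
  rw [Measure.map_apply hZ' hB] at hμ
  exact measure_eq_zero_iff_ae_notMem.1 hμ

/-- The strong law of large numbers for a Markov chain whose uniformly minorized transition kernel
depends on a parameter. -/
theorem ae_tendsto_average {μ : Measure Ξ} [IsFiniteMeasure μ] {ι : Ξ → W} (hι : Measurable ι)
    {X : ℕ → Ξ → E} (hX : ∀ n, Measurable (X n))
    (hM : IsMarkovProcess (liftKernel κ) μ fun n ω => (ι ω, X n ω))
    (hinv : ∀ᵐ w ∂μ.map ι, ∀ A, MeasurableSet A → ∫⁻ x, κ (w, x) A ∂π w = π w A)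
    (hmin : ∀ᵐ w ∂μ.map ι, ∃ ν : Measure E, ν ≠ 0 ∧ ∀ x, ν ≤ κ (w, x))
    {f : W × E → ℝ} (hf : Measurable f)
    (hfi : ∀ᵐ w ∂μ.map ι, Integrable (fun x => f (w, x)) (π w)) :
    ∀ᵐ ω ∂μ, Tendsto (fun n : ℕ => 1 / (n : ℝ) * ∑ k ∈ Finset.range n, f (ι ω, X k ω)) atTop
      (𝓝 (∫ x, f (ι ω, x) ∂π (ι ω))) := by
  set a : W → ℝ := fun w => ∫ x, f (w, x) ∂π w with ha
  set b : W → ℝ := fun w => ∫ x, |f (w, x)| ∂π w with hb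
  have ham : Measurable a := (hf.stronglyMeasurable.integral_kernel_prod_right').measurable
  have hbm : Measurable b := (hf.abs.stronglyMeasurable.integral_kernel_prod_right').measurable
  have hb0 (w : W) : 0 ≤ b w := integral_nonneg fun x => abs_nonneg _
  -- The mean of `|f|` need not be integrable in the parameter. Dividing by `1 + b` bounds the mean
  -- of `|F|` by `2 * b / (1 + b) ≤ 2`, and the factor is constant along each path, so it can be
  -- undone at the end.
  set F : W × E → ℝ := fun z => (1 + b z.1)⁻¹ * (f z - a z.1) with hFdef
  have hF : Measurable F := by fun_prop
  have hF0 : ∀ᵐ w ∂μ.map ι, ∫ x, F (w, x) ∂π w = 0 := by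
    filter_upwards [hfi] with w hw
    simp only [hFdef]
    rw [integral_const_mul, integral_sub hw (integrable_const _)]
    simp [ha]
  have hFi : Integrable F (μ.map ι ⊗ₘ π) := by
    rw [Measure.integrable_compProd_iff hF.aestronglyMeasurable]
    have hsub {w : W} (hw : Integrable (fun x => f (w, x)) (π w)) :
        Integrable (fun x => f (w, x) - a w) (π w) := hw.sub (integrable_const _)
    refine ⟨hfi.mono fun w hw => (hsub hw).const_mul (1 + b w)⁻¹, ?_⟩
    refine Integrable.of_bound
      (hF.norm.stronglyMeasurable.integral_kernel_prod_right').aestronglyMeasurable 2 ?_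
    filter_upwards [hfi] with w hw
    have hb1 : 0 < 1 + b w := by linarith [hb0 w]
    have hab : |a w| ≤ b w := abs_integral_le_integral_abs
    have hle : ∫ x, |f (w, x) - a w| ∂π w ≤ b w + |a w| := by
      calc ∫ x, |f (w, x) - a w| ∂π w ≤ ∫ x, (|f (w, x)| + |a w|) ∂π w :=
            integral_mono (hsub hw).abs (hw.abs.add (integrable_const _)) fun x => abs_sub _ _
        _ = b w + |a w| := by rw [integral_add hw.abs (integrable_const _)]; simp [hb]
    have hnorm (x : E) : ‖F (w, x)‖ = (1 + b w)⁻¹ * |f (w, x) - a w| := by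
      rw [Real.norm_eq_abs, hFdef, abs_mul, abs_of_pos (inv_pos.2 hb1)]
    simp_rw [hnorm]
    rw [integral_const_mul, Real.norm_eq_abs, abs_of_nonneg
      (mul_nonneg (inv_pos.2 hb1).le (integral_nonneg fun x => abs_nonneg _)),
      inv_mul_le_iff₀ hb1]
    linarith [hb0 w]
  have h1 : ∀ᵐ ω ∂μ, ∀ m : ℕ,
      ¬ ExceedsSlope (1 / (m + 1 : ℝ)) fun n => ∑ k ∈ Finset.range n, F (ι ω, X k ω) :=
    ae_all_iff.2 fun m => ae_notMem_exceedSet hι hX hM hinv hmin hF hFi hF0 (by positivity)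
  have h2 : ∀ᵐ ω ∂μ, ∀ m : ℕ,
      ¬ ExceedsSlope (1 / (m + 1 : ℝ)) fun n => ∑ k ∈ Finset.range n, -F (ι ω, X k ω) :=
    ae_all_iff.2 fun m => ae_notMem_exceedSet hι hX hM hinv hmin (F := fun z => -F z) hF.neg
      hFi.neg (hF0.mono fun w hw => by rw [integral_neg, hw, neg_zero]) (by positivity)
  filter_upwards [h1, h2] with ω hω1 hω2
  simp_rw [Finset.sum_neg_distrib] at hω2
  have hlim := (tendsto_average_of_not_exceedsSlope hω1 hω2).const_mul (1 + b (ι ω))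
  have hb1 : 1 + b (ι ω) ≠ 0 := by linarith [hb0 (ι ω)]
  have hlim2 := hlim.add_const (a (ι ω))
  rw [mul_zero, zero_add] at hlim2
  refine hlim2.congr' ?_
  filter_upwards [eventually_gt_atTop 0] with n hn
  have hn' : (n : ℝ) ≠ 0 := by exact_mod_cast hn.ne'
  simp only [hFdef, ← Finset.mul_sum, Finset.sum_sub_distrib, Finset.sum_const, Finset.card_range,
    nsmul_eq_mul]
  field_simp
  ring

end RandomKernel

/-! ### From conditional probabilities to Markov chains. -/

section ConditionalLaw

variable {W E Ξ : Type*} [MeasurableSpace W] [MeasurableSpace E]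
  {m : MeasurableSpace Ξ} [mΞ : MeasurableSpace Ξ]
  {P : Measure Ξ} [IsProbabilityMeasure P]

/-- If, on an event `C` of the past `m`, the conditional law of `Y'` is `κ (ι, Y)`, then on this
event the joint law of `ι` and `Y'` is obtained from that of `ι` and `Y` by a step of the lifted
kernel. -/
lemma map_restrict_eq_bind_liftKernel (κ : Kernel (W × E) E) [IsMarkovKernel κ]
    (hm : m ≤ mΞ) {ι : Ξ → W} (hι : Measurable[m] ι) {Y Y' : Ξ → E}
    (hY : Measurable[m] Y) (hY' : Measurable Y') {C : Set Ξ} (hC : MeasurableSet[m] C)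
    (hstep : ∀ A, MeasurableSet A → ∀ᵐ ω ∂P, ω ∈ C →
      (P⟦Y' ⁻¹' A | m⟧) ω = (κ (ι ω, Y ω)).real A) :
    (P.restrict C).map (fun ω => (ι ω, Y' ω)) =
      ((P.restrict C).map fun ω => (ι ω, Y ω)).bind (liftKernel κ) := by
  have hι' : Measurable ι := hι.mono hm le_rfl
  have hYm : Measurable Y := hY.mono hm le_rfl
  refine Measure.ext_prod fun {D A} hD hA => ?_
  have hκA : Measurable fun ω => κ (ι ω, Y ω) A :=
    (Kernel.measurable_coe κ hA).comp (hι'.prodMk hYm)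
  have hF : MeasurableSet[m] (ι ⁻¹' D ∩ C) := (hι hD).inter hC
  have hFm : MeasurableSet (ι ⁻¹' D ∩ C) := hm _ hF
  have hpt (ω : Ξ) : liftKernel κ (ι ω, Y ω) (D ×ˢ A) =
      (ι ⁻¹' D).indicator (fun ω => κ (ι ω, Y ω) A) ω := by
    rw [liftKernel_apply, Measure.map_apply measurable_prodMk_left (hD.prod hA)]
    by_cases h : ι ω ∈ D
    · rw [Set.indicator_of_mem (show ω ∈ ι ⁻¹' D from h), Set.mk_preimage_prod_right h]
    · rw [Set.indicator_of_notMem (show ω ∉ ι ⁻¹' D from h), Set.mk_preimage_prod_right_eq_empty h,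
        measure_empty]
  rw [Measure.map_apply (hι'.prodMk hY') (hD.prod hA), Measure.bind_apply (hD.prod hA)
    (Kernel.measurable _).aemeasurable, lintegral_map (Kernel.measurable_coe _ (hD.prod hA))
    (hι'.prodMk hYm)]
  simp_rw [hpt]
  rw [lintegral_indicator (hι' hD), Measure.restrict_restrict (hι' hD), Set.mk_preimage_prod,
    Measure.restrict_apply ((hι' hD).inter (hY' hA))]
  -- The set `ι ⁻¹' D ∩ C` belongs to the past, so the conditional probability integrates over it to
  -- the probability of the intersection. A single set `A` at a time suffices; no regular
  -- conditional law is needed.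
  have hint : ∫ ω in ι ⁻¹' D ∩ C, (κ (ι ω, Y ω)).real A ∂P = P.real (Y' ⁻¹' A ∩ (ι ⁻¹' D ∩ C)) := by
    have h1 := setIntegral_condExp (μ := P) hm (f := (Y' ⁻¹' A).indicator fun _ => (1 : ℝ))
      ((integrable_const 1).indicator (hY' hA)) hF
    rw [integral_indicator_const _ (hY' hA), measureReal_restrict_apply (hY' hA), smul_eq_mul,
      mul_one] at h1
    rw [← h1]
    exact setIntegral_congr_ae hFm ((hstep A hA).mono fun ω h hω => (h hω.2).symm)
  have h2 : ∫⁻ ω in ι ⁻¹' D ∩ C, κ (ι ω, Y ω) A ∂P = P (Y' ⁻¹' A ∩ (ι ⁻¹' D ∩ C)) := by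
    have h3 : ∫⁻ ω in ι ⁻¹' D ∩ C, κ (ι ω, Y ω) A ∂P ≠ ∞ := by
      refine ne_top_of_le_ne_top ENNReal.one_ne_top ?_
      calc ∫⁻ ω in ι ⁻¹' D ∩ C, κ (ι ω, Y ω) A ∂P ≤ ∫⁻ _ in ι ⁻¹' D ∩ C, 1 ∂P :=
            lintegral_mono fun ω => prob_le_one
        _ ≤ 1 := by rw [setLIntegral_one]; exact prob_le_one
    simp only [measureReal_def] at hint
    rw [integral_toReal hκA.aemeasurable (ae_of_all _ fun ω => measure_lt_top _ _)] at hint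
    exact (ENNReal.toReal_eq_toReal_iff' h3 (measure_ne_top _ _)).1 hint
  rw [h2]
  congr 1
  ext ω
  simp only [Set.mem_inter_iff]
  tauto

variable {κ : Kernel (W × E) E} [IsMarkovKernel κ] {π : Kernel W E} [IsMarkovKernel π]

/-- A process whose conditional laws are given by a kernel that depends on a parameter is a Markov
chain, jointly with the parameter. -/
lemma isMarkovProcess_of_condExp {ℱ : ℕ → MeasurableSpace Ξ} (hℱ : ∀ n, ℱ n ≤ mΞ) {ι : Ξ → W}
    (hι : ∀ n, Measurable[ℱ n] ι) {X : ℕ → Ξ → E}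
    (hX : ∀ i n, i ≤ n → Measurable[ℱ n] (X i)) {S : Set W} (hS : MeasurableSet S)
    (hstep : ∀ n A, MeasurableSet A → ∀ᵐ ω ∂P, ι ω ∈ S →
      (P⟦X (n + 1) ⁻¹' A | ℱ n⟧) ω = (κ (ι ω, X n ω)).real A) :
    IsMarkovProcess (liftKernel κ) (P.restrict (ι ⁻¹' S)) fun n ω => (ι ω, X n ω) := by
  intro n A hA
  have hbox : MeasurableSet[ℱ n] {ω | ∀ i ≤ n, (ι ω, X i ω) ∈ A i} := by
    have : {ω | ∀ i ≤ n, (ι ω, X i ω) ∈ A i} =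
        ⋂ i, ⋂ (_ : i ≤ n), (fun ω => (ι ω, X i ω)) ⁻¹' A i := by
      ext ω; simp
    rw [this]
    exact MeasurableSet.iInter fun i => MeasurableSet.iInter fun hi =>
      ((hι n).prodMk (hX i n hi)) (hA i)
  rw [Measure.restrict_restrict (hℱ n _ hbox)]
  exact map_restrict_eq_bind_liftKernel κ (hℱ n) (hι n) (hX n n le_rfl)
    ((hX (n + 1) (n + 1) le_rfl).mono (hℱ _) le_rfl) (hbox.inter (hι n hS))
    fun B hB => (hstep n B hB).mono fun ω h hω => h hω.2

/-- The strong law of large numbers for a process whose conditional laws are given by a uniformly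
minorized kernel that depends on a parameter. -/
theorem ae_tendsto_average_of_condExp {ℱ : ℕ → MeasurableSpace Ξ} (hℱ : ∀ n, ℱ n ≤ mΞ) {ι : Ξ → W}
    (hι : ∀ n, Measurable[ℱ n] ι) {X : ℕ → Ξ → E}
    (hX : ∀ i n, i ≤ n → Measurable[ℱ n] (X i)) {S : Set W} (hS : MeasurableSet S)
    (hstep : ∀ n A, MeasurableSet A → ∀ᵐ ω ∂P, ι ω ∈ S →
      (P⟦X (n + 1) ⁻¹' A | ℱ n⟧) ω = (κ (ι ω, X n ω)).real A)
    (hinv : ∀ w ∈ S, ∀ A, MeasurableSet A → ∫⁻ x, κ (w, x) A ∂π w = π w A)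
    (hmin : ∀ w ∈ S, ∃ ν : Measure E, ν ≠ 0 ∧ ∀ x, ν ≤ κ (w, x))
    {f : W × E → ℝ} (hf : Measurable f) (hfi : ∀ w ∈ S, Integrable (fun x => f (w, x)) (π w)) :
    ∀ᵐ ω ∂P, ι ω ∈ S → Tendsto
      (fun n : ℕ => 1 / (n : ℝ) * ∑ k ∈ Finset.range n, f (ι ω, X k ω)) atTop
      (𝓝 (∫ x, f (ι ω, x) ∂π (ι ω))) := by
  have hι' : Measurable ι := (hι 0).mono (hℱ 0) le_rfl
  have hmem : ∀ᵐ w ∂(P.restrict (ι ⁻¹' S)).map ι, w ∈ S := by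
    refine (ae_map_iff (p := fun w => w ∈ S) hι'.aemeasurable hS).2 ?_
    exact ae_restrict_mem (hι' hS)
  exact (ae_restrict_iff' (hι' hS)).1 (ae_tendsto_average hι'
    (fun n => (hX n n le_rfl).mono (hℱ n) le_rfl)
    (isMarkovProcess_of_condExp hℱ hι hX hS hstep) (hmem.mono hinv) (hmem.mono hmin) hf
    (hmem.mono hfi))

end ConditionalLaw

/-! ### Invariance and minorization of the Metropolis–Hastings step. -/

section MetropolisHastings

variable {d : ℕ} {Ω D : Set (Space d)} {ρ : Space d → ℝ} {q : Space d → Space d → ℝ}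

/-- The part of a Metropolis-Hastings step that comes from an accepted proposal. -/
def mhMove (q : Space d → Space d → ℝ) (τ : Space d → ℝ) (x : Space d) : Measure (Space d) :=
  densityMeasure fun y => q x y * mhAccept q τ x y

lemma mhStep_eq (q : Space d → Space d → ℝ) (τ : Space d → ℝ) (x : Space d) :
    mhStep q τ x = mhMove q τ x + (1 - mhMove q τ x Set.univ) • Measure.dirac x := rfl

lemma mhAccept_le_one (q : Space d → Space d → ℝ) (τ : Space d → ℝ) (x y : Space d) :
    mhAccept q τ x y ≤ 1 := by
  unfold mhAccept
  split_ifs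
  · exact le_rfl
  · exact min_le_left _ _

lemma densityMeasure_apply (f : Space d → ℝ) {A : Set (Space d)} (hA : MeasurableSet A) :
    densityMeasure f A = ∫⁻ y in A, ENNReal.ofReal (f y) :=
  withDensity_apply _ hA

/-- The target varies with the parameter, as for a random cell, so only its values along `X` and `Y`
are assumed measurable. -/
lemma measurable_mul_mhAccept {α : Type*} [MeasurableSpace α]
    (hq : Measurable fun z : Space d × Space d => q z.1 z.2) {τ : α → Space d → ℝ}
    {X Y : α → Space d} (hX : Measurable X) (hY : Measurable Y)
    (hτX : Measurable fun a => τ a (X a)) (hτY : Measurable fun a => τ a (Y a)) :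
    Measurable fun a => q (X a) (Y a) * mhAccept q (τ a) (X a) (Y a) := by
  have hXY : Measurable fun a => q (X a) (Y a) := hq.comp (hX.prodMk hY)
  have hYX : Measurable fun a => q (Y a) (X a) := hq.comp (hY.prodMk hX)
  refine hXY.mul ?_
  unfold mhAccept
  exact Measurable.ite (measurableSet_eq_fun (hτX.mul hXY) measurable_const) measurable_const
    (measurable_const.min ((hτY.mul hYX).div (hτX.mul hXY)))

lemma BoundedDensities.target_pos (H : BoundedDensities Ω ρ q) {x : Space d} (hx : x ∈ Ω) :
    0 < ρ x := by
  obtain ⟨c, C, hc, -, hρ, -⟩ := H.bounds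
  exact hc.trans (hρ x hx).1

lemma BoundedDensities.proposal_pos (H : BoundedDensities Ω ρ q) {x y : Space d} (hx : x ∈ Ω)
    (hy : y ∈ Ω) : 0 < q x y := by
  obtain ⟨c, C, hc, -, -, hq⟩ := H.bounds
  exact hc.trans (hq x hx y hy).1

/-- No move out of the support of the target is accepted. -/
lemma mul_mhAccept_eq_zero (H : BoundedDensities Ω ρ q) (hDΩ : D ⊆ Ω) {x y : Space d} (hx : x ∈ D)
    (hy : y ∉ D) : q x y * mhAccept q (D.indicator ρ) x y = 0 := by
  have hρ := H.target_pos (hDΩ hx)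
  unfold mhAccept
  rw [Set.indicator_of_mem hx, Set.indicator_of_notMem hy]
  split_ifs with h
  · rcases mul_eq_zero.1 h with h | h
    · exact absurd h hρ.ne'
    · simp [h]
  · simp

/-- The right side is symmetric in `x` and `y`, which is detailed balance, and it is bounded below
by the square of the lower density bound. -/
lemma target_mul_mhAccept (H : BoundedDensities Ω ρ q) (hDΩ : D ⊆ Ω) {x y : Space d} (hx : x ∈ D)
    (hy : y ∈ D) : ρ x * (q x y * mhAccept q (D.indicator ρ) x y) =
      min (ρ x * q x y) (ρ y * q y x) := by
  have h : 0 < ρ x * q x y := mul_pos (H.target_pos (hDΩ hx)) (H.proposal_pos (hDΩ hx) (hDΩ hy))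
  unfold mhAccept
  rw [Set.indicator_of_mem hx, Set.indicator_of_mem hy, if_neg h.ne', ← mul_assoc,
    mul_min_of_nonneg _ _ h.le, mul_one, mul_div_cancel₀ _ h.ne']

/-- It ensures that the truncated subtraction in `mhStep` is a true one, so that a step has total
mass `1`. -/
lemma mhMove_univ_le_one (H : BoundedDensities Ω ρ q) (τ : Space d → ℝ) {x : Space d} (hx : x ∈ Ω) :
    mhMove q τ x Set.univ ≤ 1 := by
  have := H.isProbabilityMeasure_proposal x hx
  rw [mhMove, densityMeasure_apply _ MeasurableSet.univ]
  calc ∫⁻ y in Set.univ, ENNReal.ofReal (q x y * mhAccept q τ x y)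
      ≤ ∫⁻ y in Set.univ, ENNReal.ofReal (q x y) := lintegral_mono fun y =>
        ENNReal.ofReal_le_ofReal (mul_le_of_le_one_right (H.proposal_nonneg x hx y)
          (mhAccept_le_one _ _ _ _))
    _ = densityMeasure (q x) Set.univ := (densityMeasure_apply _ MeasurableSet.univ).symm
    _ = 1 := measure_univ

lemma isProbabilityMeasure_mhStep (H : BoundedDensities Ω ρ q) (τ : Space d → ℝ) {x : Space d}
    (hx : x ∈ Ω) : IsProbabilityMeasure (mhStep q τ x) := by
  constructor
  rw [mhStep_eq, Measure.add_apply, Measure.smul_apply, measure_univ (μ := Measure.dirac x),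
    smul_eq_mul, mul_one]
  exact add_tsub_cancel_of_le (mhMove_univ_le_one H τ hx)

lemma mhStep_compl_eq_zero (H : BoundedDensities Ω ρ q) (hD : MeasurableSet D) (hDΩ : D ⊆ Ω)
    {x : Space d} (hx : x ∈ D) : mhStep q (D.indicator ρ) x Dᶜ = 0 := by
  rw [mhStep_eq, Measure.add_apply, Measure.smul_apply, Measure.dirac_apply' _ hD.compl,
    Set.indicator_of_notMem (Set.notMem_compl_iff.2 hx), smul_zero, add_zero, mhMove,
    densityMeasure_apply _ hD.compl]
  refine (setLIntegral_congr_fun hD.compl fun y hy => ?_).trans lintegral_zero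
  simp only [mul_mhAccept_eq_zero H hDΩ hx hy, ENNReal.ofReal_zero]

lemma targetMeasure_restrict_apply (hD : MeasurableSet D) (hDΩ : D ⊆ Ω)
    {A : Set (Space d)} (hA : MeasurableSet A) :
    targetMeasure Ω ρ (D ∩ A) = ∫⁻ x in D ∩ A, ENNReal.ofReal (ρ x) := by
  rw [targetMeasure, withDensity_apply _ (hD.inter hA), Measure.restrict_restrict (hD.inter hA),
    Set.inter_eq_left.2 (Set.inter_subset_left.trans hDΩ)]

/-- The accepted flow is at least `c * c`, and dividing by `ρ x < C` bounds the accepted density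
below by `c * c / C`. This number is also below `c < ρ`, hence the bound for the target itself,
which serves the states outside the cell. -/
lemma exists_minorization (H : BoundedDensities Ω ρ q) :
    ∃ β : ℝ≥0∞, 0 < β ∧ ∀ D : Set (Space d), MeasurableSet D → D ⊆ Ω →
      β • volume.restrict D ≤ (targetMeasure Ω ρ).restrict D ∧
      ∀ x ∈ D, β • volume.restrict D ≤ mhStep q (D.indicator ρ) x := by
  obtain ⟨c, C, hc, hcC, hρ, hq⟩ := H.bounds
  refine ⟨ENNReal.ofReal (c * c / C), ENNReal.ofReal_pos.2 (by have := hc.trans hcC; positivity),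
    fun D hD hDΩ => ⟨Measure.le_iff.2 fun A hA => ?_, fun x hx => Measure.le_iff.2 fun A hA => ?_⟩⟩
  · calc (ENNReal.ofReal (c * c / C) • volume.restrict D) A
        = ∫⁻ _ in D ∩ A, ENNReal.ofReal (c * c / C) := by
          rw [Measure.smul_apply, Measure.restrict_apply hA, setLIntegral_const, smul_eq_mul,
            Set.inter_comm]
      _ ≤ ∫⁻ x in D ∩ A, ENNReal.ofReal (ρ x) := by
          refine setLIntegral_mono' (hD.inter hA) fun x hx => ENNReal.ofReal_le_ofReal ?_
          have hρx := hρ x (hDΩ hx.1)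
          rw [div_le_iff₀ (hc.trans hcC)]
          nlinarith
      _ = (targetMeasure Ω ρ).restrict D A := by
          rw [Measure.restrict_apply hA, Set.inter_comm A, targetMeasure_restrict_apply hD hDΩ hA]
  · calc (ENNReal.ofReal (c * c / C) • volume.restrict D) A
        = ∫⁻ _ in A ∩ D, ENNReal.ofReal (c * c / C) := by
          rw [Measure.smul_apply, Measure.restrict_apply hA, setLIntegral_const, smul_eq_mul]
      _ ≤ ∫⁻ y in A ∩ D, ENNReal.ofReal (q x y * mhAccept q (D.indicator ρ) x y) := by
          refine setLIntegral_mono' (hA.inter hD) fun y hy => ENNReal.ofReal_le_ofReal ?_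
          have h1 := target_mul_mhAccept H hDΩ hx hy.2
          have hρx := hρ x (hDΩ hx)
          have hρy := hρ y (hDΩ hy.2)
          have hqx := hq x (hDΩ hx) y (hDΩ hy.2)
          have hqy := hq y (hDΩ hy.2) x (hDΩ hx)
          have h2 : c * c ≤ ρ x * (q x y * mhAccept q (D.indicator ρ) x y) := by
            rw [h1]
            exact le_min (mul_le_mul hρx.1.le hqx.1.le hc.le (hc.trans hρx.1).le)
              (mul_le_mul hρy.1.le hqy.1.le hc.le (hc.trans hρy.1).le)
          have h3 : 0 < q x y * mhAccept q (D.indicator ρ) x y :=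
            (mul_pos_iff_of_pos_left (hc.trans hρx.1)).1 ((mul_pos hc hc).trans_le h2)
          rw [div_le_iff₀ (hc.trans hcC)]
          nlinarith [mul_lt_mul_of_pos_right hρx.2 h3]
      _ ≤ ∫⁻ y in A, ENNReal.ofReal (q x y * mhAccept q (D.indicator ρ) x y) :=
          lintegral_mono_set Set.inter_subset_left
      _ = mhMove q (D.indicator ρ) x A := (densityMeasure_apply _ hA).symm
      _ ≤ mhStep q (D.indicator ρ) x A := by
          rw [mhStep_eq, Measure.add_apply]
          exact le_self_add

lemma lintegral_targetMeasure_restrict (H : BoundedDensities Ω ρ q) (hD : MeasurableSet D)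
    (hDΩ : D ⊆ Ω) {f : Space d → ℝ≥0∞} (hf : Measurable f) :
    ∫⁻ x in D, f x ∂targetMeasure Ω ρ = ∫⁻ x in D, ENNReal.ofReal (ρ x) * f x := by
  rw [targetMeasure, restrict_withDensity hD,
    lintegral_withDensity_eq_lintegral_mul _ H.measurable_target.ennreal_ofReal hf,
    Measure.restrict_restrict hD, Set.inter_eq_left.2 hDΩ]
  rfl

lemma measurable_mhMove_apply (H : BoundedDensities Ω ρ q) (hD : MeasurableSet D)
    {A : Set (Space d)} (hA : MeasurableSet A) :
    Measurable fun x => mhMove q (D.indicator ρ) x A := by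
  simp_rw [mhMove, densityMeasure_apply _ hA]
  have hτ := H.measurable_target.indicator hD
  exact Measurable.lintegral_prod_right' (f := fun z : Space d × Space d =>
      ENNReal.ofReal (q z.1 z.2 * mhAccept q (D.indicator ρ) z.1 z.2))
    (measurable_mul_mhAccept (τ := fun _ => D.indicator ρ) H.measurable_proposal measurable_fst
      measurable_snd (hτ.comp measurable_fst) (hτ.comp measurable_snd)).ennreal_ofReal

/-- The restriction of the target to `D` is invariant for the Metropolis-Hastings step. -/
lemma lintegral_mhStep (H : BoundedDensities Ω ρ q) (hD : MeasurableSet D) (hDΩ : D ⊆ Ω)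
    {A : Set (Space d)} (hA : MeasurableSet A) :
    ∫⁻ x in D, mhStep q (D.indicator ρ) x A ∂targetMeasure Ω ρ = targetMeasure Ω ρ (D ∩ A) := by
  set τ := D.indicator ρ with hτ
  set k : Space d → Space d → ℝ≥0∞ := fun x y => ENNReal.ofReal (q x y * mhAccept q τ x y) with hk
  have hτm : Measurable τ := H.measurable_target.indicator hD
  have hkm : Measurable fun z : Space d × Space d => k z.1 z.2 :=
    (measurable_mul_mhAccept (τ := fun _ => τ) H.measurable_proposal measurable_fst
      measurable_snd (hτm.comp measurable_fst) (hτm.comp measurable_snd)).ennreal_ofReal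
  have hmove {B : Set (Space d)} (hB : MeasurableSet B) : Measurable fun x => mhMove q τ x B :=
    measurable_mhMove_apply H hD hB
  have hρm : Measurable fun x => ENNReal.ofReal (ρ x) := H.measurable_target.ennreal_ofReal
  have hkx (x : Space d) : Measurable (k x) := hkm.comp measurable_prodMk_left
  have hmul {B : Set (Space d)} (hB : MeasurableSet B) :
      Measurable fun x => ENNReal.ofReal (ρ x) * mhMove q τ x B := hρm.mul (hmove hB)
  have hsymm : ∀ x ∈ D, ∀ y ∈ D, ENNReal.ofReal (ρ x) * k x y = ENNReal.ofReal (ρ y) * k y x := by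
    intro x hx y hy
    rw [hk, ← ENNReal.ofReal_mul (H.target_pos (hDΩ hx)).le,
      ← ENNReal.ofReal_mul (H.target_pos (hDΩ hy)).le, target_mul_mhAccept H hDΩ hx hy,
      target_mul_mhAccept H hDΩ hy hx, min_comm]
  have hmoveD : ∀ x ∈ D, ∀ B, MeasurableSet B → mhMove q τ x B = ∫⁻ y in D ∩ B, k x y := by
    intro x hx B hB
    have h1 : ∀ y, B.indicator (k x) y = (D ∩ B).indicator (k x) y := by
      intro y
      by_cases hy : y ∈ D
      · by_cases hyB : y ∈ B <;> simp [hy, hyB]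
      · by_cases hyB : y ∈ B <;> simp [hy, hyB, hk, mul_mhAccept_eq_zero H hDΩ hx hy, hτ]
    rw [mhMove, densityMeasure_apply _ hB, ← lintegral_indicator hB,
      ← lintegral_indicator (hD.inter hB)]
    exact lintegral_congr h1
  -- Tonelli and detailed balance: the flow that enters `A` by moves equals the flow that leaves `D
  -- ∩ A` by moves. The rejected mass at the points of `D ∩ A` then completes the target mass of `D
  -- ∩ A`.
  have hmoves : ∫⁻ x in D, ENNReal.ofReal (ρ x) * mhMove q τ x A =
      ∫⁻ y in D ∩ A, ENNReal.ofReal (ρ y) * mhMove q τ y Set.univ := by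
    calc ∫⁻ x in D, ENNReal.ofReal (ρ x) * mhMove q τ x A
        = ∫⁻ x in D, ∫⁻ y in D ∩ A, ENNReal.ofReal (ρ x) * k x y := by
          refine setLIntegral_congr_fun hD fun x hx => ?_
          rw [hmoveD x hx A hA, lintegral_const_mul _ (hkx _)]
      _ = ∫⁻ y in D ∩ A, ∫⁻ x in D, ENNReal.ofReal (ρ x) * k x y :=
          lintegral_lintegral_swap ((hρm.comp measurable_fst).mul hkm).aemeasurable
      _ = ∫⁻ y in D ∩ A, ∫⁻ x in D, ENNReal.ofReal (ρ y) * k y x :=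
          setLIntegral_congr_fun (hD.inter hA) fun y hy =>
            setLIntegral_congr_fun hD fun x hx => hsymm x hx y hy.1
      _ = ∫⁻ y in D ∩ A, ENNReal.ofReal (ρ y) * mhMove q τ y Set.univ := by
          refine setLIntegral_congr_fun (hD.inter hA) fun y hy => ?_
          rw [hmoveD y hy.1 Set.univ MeasurableSet.univ, Set.inter_univ,
            lintegral_const_mul _ (hkx _)]
  have hstay : Measurable fun x => (1 - mhMove q τ x Set.univ) * A.indicator 1 x :=
    (measurable_const.sub (hmove MeasurableSet.univ)).mul (measurable_one.indicator hA)
  have hstep (x : Space d) : mhStep q τ x A =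
      mhMove q τ x A + (1 - mhMove q τ x Set.univ) * A.indicator 1 x := by
    rw [mhStep_eq, Measure.add_apply, Measure.smul_apply, Measure.dirac_apply' _ hA, smul_eq_mul]
  simp_rw [hstep]
  rw [lintegral_targetMeasure_restrict H hD hDΩ (f := fun x => mhMove q τ x A +
    (1 - mhMove q τ x Set.univ) * A.indicator 1 x) ((hmove hA).add hstay)]
  simp_rw [mul_add]
  rw [lintegral_add_left (hmul hA), hmoves]
  have hstays : ∫⁻ x in D, ENNReal.ofReal (ρ x) *
      ((1 - mhMove q τ x Set.univ) * A.indicator 1 x) =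
      ∫⁻ x in D ∩ A, ENNReal.ofReal (ρ x) * (1 - mhMove q τ x Set.univ) := by
    rw [Set.inter_comm, ← Measure.restrict_restrict hA, ← lintegral_indicator hA]
    refine lintegral_congr fun x => ?_
    by_cases hx : x ∈ A <;> simp [hx]
  rw [hstays, ← lintegral_add_left (hmul MeasurableSet.univ),
    targetMeasure_restrict_apply hD hDΩ hA]
  refine setLIntegral_congr_fun (hD.inter hA) fun x hx => ?_
  rw [← mul_add, add_tsub_cancel_of_le (mhMove_univ_le_one H τ (hDΩ hx.1)), mul_one]

end MetropolisHastings

/-! ### Integrals against densities. -/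

section DensityIntegrals

variable {d : ℕ} {Ω D : Set (Space d)} {ρ : Space d → ℝ} {q : Space d → Space d → ℝ}

lemma integral_densityMeasure {p : Space d → ℝ} (hp : Measurable p) (hp0 : ∀ x, 0 ≤ p x)
    (g : Space d → ℝ) : ∫ x, g x ∂densityMeasure p = ∫ x, p x * g x := by
  rw [densityMeasure, integral_withDensity_eq_integral_toReal_smul hp.ennreal_ofReal
    (ae_of_all _ fun x => ENNReal.ofReal_lt_top)]
  simp [ENNReal.toReal_ofReal (hp0 _)]

lemma integrable_densityMeasure {p : Space d → ℝ} (hp : Measurable p) (hp0 : ∀ x, 0 ≤ p x)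
    {g : Space d → ℝ} (hg : Integrable (fun x => p x * g x)) :
    Integrable g (densityMeasure p) := by
  rw [densityMeasure, integrable_withDensity_iff_integrable_smul' hp.ennreal_ofReal
    (ae_of_all _ fun x => ENNReal.ofReal_lt_top)]
  simpa [ENNReal.toReal_ofReal (hp0 _)] using hg

lemma targetMeasure_restrict (hD : MeasurableSet D) (hDΩ : D ⊆ Ω) :
    (targetMeasure Ω ρ).restrict D = densityMeasure (D.indicator ρ) := by
  rw [targetMeasure, restrict_withDensity hD, Measure.restrict_restrict hD,
    Set.inter_eq_left.2 hDΩ, densityMeasure, ← withDensity_indicator hD]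
  congr 1
  ext x
  by_cases hx : x ∈ D <;> simp [hx]

lemma indicator_target_nonneg (H : BoundedDensities Ω ρ q) (hDΩ : D ⊆ Ω) (x : Space d) :
    0 ≤ D.indicator ρ x :=
  Set.indicator_nonneg (fun _ hx => (H.target_pos (hDΩ hx)).le) x

/-- As `ρ` is positive on `Ω`, a null cell is Lebesgue null, and hence missed by draws from any
density. -/
lemma volume_eq_zero_of_targetMeasure (H : BoundedDensities Ω ρ q) (hD : MeasurableSet D)
    (hDΩ : D ⊆ Ω) (h : targetMeasure Ω ρ D = 0) : volume D = 0 := by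
  have h1 := targetMeasure_restrict_apply (ρ := ρ) hD hDΩ MeasurableSet.univ
  rw [Set.inter_univ, h] at h1
  have h2 := (lintegral_eq_zero_iff H.measurable_target.ennreal_ofReal).1 h1.symm
  have h3 := (ae_restrict_iff' hD).1 h2
  refine measure_mono_null (fun x hx => ?_) (ae_iff.1 h3)
  simp [hx, H.target_pos (hDΩ hx)]

end DensityIntegrals

/-! ### Metropolis–Hastings chains in a random cell. -/

section RandomCell

variable {d : ℕ} {Ω : Set (Space d)} {ρ : Space d → ℝ} {q : Space d → Space d → ℝ}
  {W : Type*} [MeasurableSpace W] {D : Set (W × Space d)}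

/-- The target, conditioned on the section of `D`, as a kernel; the value is irrelevant where the
section is null. -/
def cellLaw (H : BoundedDensities Ω ρ q) (hD : MeasurableSet D) : Kernel W (Space d) where
  toFun w := open Classical in
    if targetMeasure Ω ρ (Prod.mk w ⁻¹' D) = 0 then Measure.dirac 0
    else (targetMeasure Ω ρ)[|Prod.mk w ⁻¹' D]
  measurable' := by
    have := H.isProbabilityMeasure_target
    have hm : Measurable fun w => targetMeasure Ω ρ (Prod.mk w ⁻¹' D) :=
      measurable_measure_prodMk_left hD
    refine Measurable.ite (hm (measurableSet_singleton 0)) measurable_const ?_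
    refine Measure.measurable_of_measurable_coe _ fun A hA => ?_
    simp_rw [cond_apply (measurable_prodMk_left hD)]
    refine hm.inv.mul ?_
    exact measurable_measure_prodMk_left (s := D ∩ Prod.snd ⁻¹' A) (hD.inter (measurable_snd hA))

lemma cellLaw_apply (H : BoundedDensities Ω ρ q) (hD : MeasurableSet D) {w : W}
    (hw : 0 < targetMeasure Ω ρ (Prod.mk w ⁻¹' D)) :
    cellLaw H hD w = (targetMeasure Ω ρ)[|Prod.mk w ⁻¹' D] :=
  if_neg hw.ne'

instance (H : BoundedDensities Ω ρ q) (hD : MeasurableSet D) : IsMarkovKernel (cellLaw H hD) := by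
  have := H.isProbabilityMeasure_target
  refine ⟨fun w => ?_⟩
  by_cases h : targetMeasure Ω ρ (Prod.mk w ⁻¹' D) = 0
  · have : cellLaw H hD w = Measure.dirac 0 := if_pos h
    rw [this]
    infer_instance
  · rw [cellLaw_apply H hD (pos_iff_ne_zero.2 h)]
    exact cond_isProbabilityMeasure h

lemma integral_cellLaw (H : BoundedDensities Ω ρ q) (hD : MeasurableSet D) {w : W}
    (hw : 0 < targetMeasure Ω ρ (Prod.mk w ⁻¹' D)) (g : Space d → ℝ) :
    ∫ x, g x ∂cellLaw H hD w = ((targetMeasure Ω ρ).real (Prod.mk w ⁻¹' D))⁻¹ *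
      ∫ x in Prod.mk w ⁻¹' D, g x ∂targetMeasure Ω ρ := by
  rw [cellLaw_apply H hD hw, ProbabilityTheory.cond, integral_smul_measure, ENNReal.toReal_inv, smul_eq_mul,
    measureReal_def]

lemma integrable_cellLaw (H : BoundedDensities Ω ρ q) (hD : MeasurableSet D) {w : W}
    (hw : 0 < targetMeasure Ω ρ (Prod.mk w ⁻¹' D)) {g : Space d → ℝ}
    (hg : IntegrableOn g (Prod.mk w ⁻¹' D) (targetMeasure Ω ρ)) :
    Integrable g (cellLaw H hD w) := by
  rw [cellLaw_apply H hD hw, ProbabilityTheory.cond]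
  exact hg.smul_measure (ENNReal.inv_ne_top.2 hw.ne')

/-- The Metropolis-Hastings step whose target is the restriction of the target to the section of
`D`; outside of this section, a draw from its invariant law. -/
def cellKernel (H : BoundedDensities Ω ρ q) (hD : MeasurableSet D) :
    Kernel (W × Space d) (Space d) where
  toFun z := open Classical in
    if z ∈ D then mhStep q ((Prod.mk z.1 ⁻¹' D).indicator ρ) z.2 else cellLaw H hD z.1
  measurable' := by
    refine Measurable.ite hD ?_ ((cellLaw H hD).measurable.comp measurable_fst)
    have hmove {A : Set (Space d)} (hA : MeasurableSet A) : Measurable fun z : W × Space d =>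
        mhMove q ((Prod.mk z.1 ⁻¹' D).indicator ρ) z.2 A := by
      simp_rw [mhMove, densityMeasure_apply _ hA]
      have hτ : Measurable (D.indicator fun z => ρ z.2) :=
        (H.measurable_target.comp measurable_snd).indicator hD
      refine Measurable.lintegral_prod_right' (f := fun p : (W × Space d) × Space d =>
        ENNReal.ofReal (q p.1.2 p.2 * mhAccept q ((Prod.mk p.1.1 ⁻¹' D).indicator ρ) p.1.2 p.2))
        (measurable_mul_mhAccept (τ := fun p : (W × Space d) × Space d =>
          (Prod.mk p.1.1 ⁻¹' D).indicator ρ) H.measurable_proposal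
          (measurable_snd.comp measurable_fst) measurable_snd ?_ ?_).ennreal_ofReal
      · exact hτ.comp measurable_fst
      · exact hτ.comp ((measurable_fst.comp measurable_fst).prodMk measurable_snd)
    refine Measure.measurable_of_measurable_coe _ fun A hA => ?_
    simp_rw [mhStep_eq, Measure.add_apply, Measure.smul_apply, Measure.dirac_apply' _ hA]
    exact (hmove hA).add ((measurable_const.sub (hmove MeasurableSet.univ)).mul
      ((measurable_one.indicator hA).comp measurable_snd))

lemma cellKernel_apply (H : BoundedDensities Ω ρ q) (hD : MeasurableSet D) {z : W × Space d}
    (hz : z ∈ D) :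
    cellKernel H hD z = mhStep q ((Prod.mk z.1 ⁻¹' D).indicator ρ) z.2 :=
  if_pos hz

lemma cellKernel_apply_of_notMem (H : BoundedDensities Ω ρ q) (hD : MeasurableSet D)
    {z : W × Space d} (hz : z ∉ D) : cellKernel H hD z = cellLaw H hD z.1 :=
  if_neg hz

lemma isMarkovKernel_cellKernel (H : BoundedDensities Ω ρ q) (hD : MeasurableSet D)
    (hDΩ : ∀ z ∈ D, z.2 ∈ Ω) : IsMarkovKernel (cellKernel H hD) := by
  refine ⟨fun z => ?_⟩
  by_cases hz : z ∈ D
  · rw [cellKernel_apply H hD hz]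
    exact isProbabilityMeasure_mhStep H _ (hDΩ z hz)
  · rw [cellKernel_apply_of_notMem H hD hz]
    infer_instance

/-- The conditioned target charges only the section, so the values of the kernel elsewhere do not
matter, and normalization is a common factor. -/
lemma lintegral_cellKernel (H : BoundedDensities Ω ρ q) (hD : MeasurableSet D)
    (hDΩ : ∀ z ∈ D, z.2 ∈ Ω) {w : W} (hw : 0 < targetMeasure Ω ρ (Prod.mk w ⁻¹' D))
    {A : Set (Space d)} (hA : MeasurableSet A) :
    ∫⁻ x, cellKernel H hD (w, x) A ∂cellLaw H hD w = cellLaw H hD w A := by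
  have hDw : MeasurableSet (Prod.mk w ⁻¹' D) := measurable_prodMk_left hD
  rw [cellLaw_apply H hD hw, cond_apply hDw, ProbabilityTheory.cond, lintegral_smul_measure, smul_eq_mul,
    ← lintegral_mhStep H hDw (fun x hx => hDΩ _ hx) hA]
  congr 1
  exact setLIntegral_congr_fun hDw fun x hx => by rw [cellKernel_apply H hD hx]

/-- Law of large numbers arguments need one minorizing measure for all states. Off the section the
kernel is the conditioned target, which dominates the restricted target because the normalizing mass
is at most `1`. -/
lemma exists_le_cellKernel (H : BoundedDensities Ω ρ q) (hD : MeasurableSet D)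
    (hDΩ : ∀ z ∈ D, z.2 ∈ Ω) {w : W} (hw : 0 < targetMeasure Ω ρ (Prod.mk w ⁻¹' D)) :
    ∃ ν : Measure (Space d), ν ≠ 0 ∧ ∀ x, ν ≤ cellKernel H hD (w, x) := by
  have hDw : MeasurableSet (Prod.mk w ⁻¹' D) := measurable_prodMk_left hD
  have hDwΩ : Prod.mk w ⁻¹' D ⊆ Ω := fun x hx => hDΩ _ hx
  obtain ⟨β, hβ, h⟩ := exists_minorization H
  obtain ⟨h1, h2⟩ := h _ hDw hDwΩ
  refine ⟨β • volume.restrict (Prod.mk w ⁻¹' D), fun h0 => ?_, fun x => ?_⟩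
  · have h3 := congrArg (fun m => m Set.univ) h0
    simp only [Measure.smul_apply, Measure.restrict_apply_univ, smul_eq_mul, Measure.coe_zero,
      Pi.zero_apply, mul_eq_zero, hβ.ne', false_or] at h3
    have h4 := targetMeasure_restrict_apply (ρ := ρ) hDw hDwΩ MeasurableSet.univ
    rw [Set.inter_univ, setLIntegral_measure_zero _ _ h3] at h4
    exact hw.ne' h4
  · by_cases hx : (w, x) ∈ D
    · rw [cellKernel_apply H hD hx]
      exact h2 x hx
    · have := H.isProbabilityMeasure_target
      rw [cellKernel_apply_of_notMem H hD hx, cellLaw_apply H hD hw, ProbabilityTheory.cond]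
      refine h1.trans (Measure.le_iff.2 fun A _ => ?_)
      rw [Measure.smul_apply, smul_eq_mul]
      exact le_mul_of_one_le_left zero_le (ENNReal.one_le_inv.2 prob_le_one)

variable {Ξ : Type*} [mΞ : MeasurableSpace Ξ] {P : Measure Ξ} [IsProbabilityMeasure P]

/-- A process that makes Metropolis-Hastings steps while it is in the section of `D` never leaves
this section. -/
lemma ae_forall_mem_of_mhStep (H : BoundedDensities Ω ρ q) (hD : MeasurableSet D)
    (hDΩ : ∀ z ∈ D, z.2 ∈ Ω) {ℱ : ℕ → MeasurableSpace Ξ} (hℱ : ∀ n, ℱ n ≤ mΞ) {ι : Ξ → W}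
    (hι : ∀ n, Measurable[ℱ n] ι) {X : ℕ → Ξ → Space d}
    (hX : ∀ i n, i ≤ n → Measurable[ℱ n] (X i))
    (hstep : ∀ n A, MeasurableSet A → ∀ᵐ ω ∂P, (ι ω, X n ω) ∈ D →
      (P⟦X (n + 1) ⁻¹' A | ℱ n⟧) ω = (mhStep q ((Prod.mk (ι ω) ⁻¹' D).indicator ρ) (X n ω)).real A) :
    ∀ᵐ ω ∂P, (ι ω, X 0 ω) ∈ D → ∀ n, (ι ω, X n ω) ∈ D := by
  have := isMarkovKernel_cellKernel H hD hDΩ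
  have hX' (n : ℕ) : Measurable (X n) := (hX n n le_rfl).mono (hℱ n) le_rfl
  have hι' : Measurable ι := (hι 0).mono (hℱ 0) le_rfl
  have hone (n : ℕ) : ∀ᵐ ω ∂P, (ι ω, X n ω) ∈ D → (ι ω, X (n + 1) ω) ∈ D := by
    set C : Set Ξ := {ω | (ι ω, X n ω) ∈ D} with hC
    have hCm : MeasurableSet[ℱ n] C := ((hι n).prodMk (hX n n le_rfl)) hD
    have hlaw := map_restrict_eq_bind_liftKernel (cellKernel H hD) (hℱ n) (hι n) (hX n n le_rfl)
      (hX' (n + 1)) hCm fun A hA => (hstep n A hA).mono fun ω h hω => by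
        rw [h hω, cellKernel_apply H hD hω]
    have h0 := congrArg (fun m => m Dᶜ) hlaw
    rw [Measure.map_apply (hι'.prodMk (hX' _)) hD.compl,
      Measure.bind_apply hD.compl (Kernel.measurable _).aemeasurable,
      lintegral_map (Kernel.measurable_coe _ hD.compl) (hι'.prodMk (hX' n))] at h0
    have h1 : ∫⁻ ω in C, liftKernel (cellKernel H hD) (ι ω, X n ω) Dᶜ ∂P = 0 := by
      refine (setLIntegral_congr_fun (hℱ n _ hCm) fun ω hω => ?_).trans lintegral_zero
      rw [liftKernel_apply, Measure.map_apply measurable_prodMk_left hD.compl,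
        cellKernel_apply H hD hω]
      exact mhStep_compl_eq_zero H (measurable_prodMk_left hD) (fun x hx => hDΩ _ hx) hω
    rw [h1] at h0
    have h2 := (ae_restrict_iff' (hℱ n _ hCm)).1 (measure_eq_zero_iff_ae_notMem.1 h0)
    filter_upwards [h2] with ω hω hn
    simpa using hω hn
  filter_upwards [ae_all_iff.2 hone] with ω hω h0 n
  induction n with
  | zero => exact h0
  | succ n ih => exact hω n ih

/-- The strong law of large numbers for the Metropolis-Hastings chain in a random cell. -/
lemma ae_tendsto_average_of_mhStep (H : BoundedDensities Ω ρ q) (hD : MeasurableSet D)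
    (hDΩ : ∀ z ∈ D, z.2 ∈ Ω) {ℱ : ℕ → MeasurableSpace Ξ} (hℱ : ∀ n, ℱ n ≤ mΞ) {ι : Ξ → W}
    (hι : ∀ n, Measurable[ℱ n] ι) {X : ℕ → Ξ → Space d}
    (hX : ∀ i n, i ≤ n → Measurable[ℱ n] (X i))
    (hstep : ∀ n A, MeasurableSet A → ∀ᵐ ω ∂P, (ι ω, X n ω) ∈ D →
      (P⟦X (n + 1) ⁻¹' A | ℱ n⟧) ω = (mhStep q ((Prod.mk (ι ω) ⁻¹' D).indicator ρ) (X n ω)).real A)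
    {S : Set W} (hS : MeasurableSet S)
    (hSpos : ∀ w ∈ S, 0 < targetMeasure Ω ρ (Prod.mk w ⁻¹' D))
    (hX0 : ∀ᵐ ω ∂P, ι ω ∈ S → (ι ω, X 0 ω) ∈ D) {f : W × Space d → ℝ} (hf : Measurable f)
    (hfi : ∀ w ∈ S, IntegrableOn (fun x => f (w, x)) (Prod.mk w ⁻¹' D) (targetMeasure Ω ρ)) :
    ∀ᵐ ω ∂P, ι ω ∈ S → Tendsto
      (fun n : ℕ => 1 / (n : ℝ) * ∑ k ∈ Finset.range n, f (ι ω, X k ω)) atTop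
      (𝓝 (((targetMeasure Ω ρ).real (Prod.mk (ι ω) ⁻¹' D))⁻¹ *
        ∫ x in Prod.mk (ι ω) ⁻¹' D, f (ι ω, x) ∂targetMeasure Ω ρ)) := by
  have := isMarkovKernel_cellKernel H hD hDΩ
  have hstay := ae_forall_mem_of_mhStep H hD hDΩ hℱ hι hX hstep
  have hlim := ae_tendsto_average_of_condExp (κ := cellKernel H hD) (π := cellLaw H hD) hℱ hι hX hS
    -- The step law is known only while the chain is in the cell; as it starts there and never
    -- leaves, it holds on the event `ι ω ∈ S` of the past.
    (fun n A hA => by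
      filter_upwards [hstep n A hA, hX0, hstay] with ω h1 h2 h3 h4
      have h5 := h3 (h2 h4) n
      rw [h1 h5, cellKernel_apply H hD h5])
    (fun w hw A hA => lintegral_cellKernel H hD hDΩ (hSpos w hw) hA)
    (fun w hw => exists_le_cellKernel H hD hDΩ (hSpos w hw)) hf
    (fun w hw => integrable_cellLaw H hD (hSpos w hw) (hfi w hw))
  filter_upwards [hlim] with ω h1 h2
  rw [← integral_cellLaw H hD (hSpos _ h2)]
  exact h1 h2

end RandomCell

/-! ### Draws from a random density. -/

section Draws

variable {d : ℕ} {W : Type*} [MeasurableSpace W] {p : W → Space d → ℝ}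

/-- The law with density `p w`, as a kernel. -/
def densityKernel (hp : Measurable fun z : W × Space d => p z.1 z.2) : Kernel W (Space d) where
  toFun w := densityMeasure (p w)
  measurable' := by
    refine Measure.measurable_of_measurable_coe _ fun A hA => ?_
    simp_rw [densityMeasure_apply _ hA]
    exact Measurable.lintegral_prod_right' (f := fun z : W × Space d => ENNReal.ofReal (p z.1 z.2))
      hp.ennreal_ofReal

lemma densityKernel_apply (hp : Measurable fun z : W × Space d => p z.1 z.2) (w : W) :
    densityKernel hp w = densityMeasure (p w) := rfl

variable {Ξ : Type*} {m : MeasurableSpace Ξ} [mΞ : MeasurableSpace Ξ] {P : Measure Ξ} [IsProbabilityMeasure P]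

/-- The strong law of large numbers for draws that are, given the past, independent with a common
density. -/
lemma ae_tendsto_average_of_draws (hp : Measurable fun z : W × Space d => p z.1 z.2)
    (hprob : ∀ w, IsProbabilityMeasure (densityMeasure (p w))) {ℱ : ℕ → MeasurableSpace Ξ}
    (hℱ : ∀ n, ℱ n ≤ mΞ) {ι : Ξ → W} (hι : ∀ n, Measurable[ℱ n] ι) {X : ℕ → Ξ → Space d}
    (hX : ∀ i n, i ≤ n → Measurable[ℱ n] (X i))
    (hstep : ∀ n A, MeasurableSet A → ∀ᵐ ω ∂P,
      (P⟦X (n + 1) ⁻¹' A | ℱ n⟧) ω = (densityMeasure (p (ι ω))).real A)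
    {S : Set W} (hS : MeasurableSet S) {f : W × Space d → ℝ} (hf : Measurable f)
    (hfi : ∀ w ∈ S, Integrable (fun x => f (w, x)) (densityMeasure (p w))) :
    ∀ᵐ ω ∂P, ι ω ∈ S → Tendsto
      (fun n : ℕ => 1 / (n : ℝ) * ∑ k ∈ Finset.range n, f (ι ω, X k ω)) atTop
      (𝓝 (∫ x, f (ι ω, x) ∂densityMeasure (p (ι ω)))) := by
  have : IsMarkovKernel (densityKernel hp) := ⟨hprob⟩
  -- The draws form a Markov chain whose kernel forgets the current state; its law is both invariant
  -- and minorizing.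
  refine ae_tendsto_average_of_condExp (κ := Kernel.prodMkRight (Space d) (densityKernel hp))
    (π := densityKernel hp) hℱ hι hX hS (fun n A hA => (hstep n A hA).mono fun ω h _ => ?_)
    (fun w _ A _ => ?_) (fun w _ => ⟨densityMeasure (p w), ?_, fun x => ?_⟩) hf hfi
  · rw [h, Kernel.prodMkRight_apply, densityKernel_apply]
  · simp only [Kernel.prodMkRight_apply, lintegral_const, measure_univ, mul_one]
  · have := hprob w
    exact IsProbabilityMeasure.ne_zero _
  · rw [Kernel.prodMkRight_apply, densityKernel_apply]

/-- Draws from a density almost surely avoid a null set that is determined by the past. -/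
lemma ae_notMem_of_draw (hp : Measurable fun z : W × Space d => p z.1 z.2)
    (hprob : ∀ w, IsProbabilityMeasure (densityMeasure (p w)))
    (hm : m ≤ mΞ) {ι : Ξ → W} (hι : Measurable[m] ι) {Y : Ξ → Space d} (hY : Measurable Y)
    (hlaw : ∀ A, MeasurableSet A → ∀ᵐ ω ∂P,
      (P⟦Y ⁻¹' A | m⟧) ω = (densityMeasure (p (ι ω))).real A)
    {N : Set (W × Space d)} (hN : MeasurableSet N) (hN0 : ∀ w, volume (Prod.mk w ⁻¹' N) = 0) :
    ∀ᵐ ω ∂P, (ι ω, Y ω) ∉ N := by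
  have : IsMarkovKernel (densityKernel hp) := ⟨hprob⟩
  have hι' : Measurable ι := hι.mono hm le_rfl
  -- The kernel ignores the current state, so the constant `0` can play that part.
  have h := map_restrict_eq_bind_liftKernel (P := P)
    (Kernel.prodMkRight (Space d) (densityKernel hp)) hm hι
    (Y := fun _ => 0) (measurable_const) hY (C := Set.univ) (MeasurableSet.univ)
    (fun A hA => (hlaw A hA).mono fun ω h _ => by
      rw [h, Kernel.prodMkRight_apply, densityKernel_apply])
  have h0 := congrArg (fun m => m N) h
  rw [Measure.restrict_univ, Measure.map_apply (hι'.prodMk hY) hN,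
    Measure.bind_apply hN (Kernel.measurable _).aemeasurable,
    lintegral_map (Kernel.measurable_coe _ hN) (hι'.prodMk measurable_const)] at h0
  refine measure_eq_zero_iff_ae_notMem.1 (h0.trans ?_)
  refine (lintegral_congr fun ω => ?_).trans lintegral_zero
  rw [liftKernel_apply, Measure.map_apply measurable_prodMk_left hN, Kernel.prodMkRight_apply,
    densityKernel_apply]
  exact withDensity_absolutelyContinuous _ _ (hN0 _)

end Draws

/-! ### Averages with finitely many extra terms. -/

section Limits

/-- Finitely many initial terms do not change the limit of an average. -/
lemma tendsto_average_add {s : ℕ → ℝ} {l : ℝ} (a : ℝ) (k : ℕ)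
    (hs : Tendsto (fun n : ℕ => 1 / (n : ℝ) * s n) atTop (𝓝 l)) :
    Tendsto (fun n : ℕ => 1 / ((k + n : ℕ) : ℝ) * (a + s n)) atTop (𝓝 l) := by
  have hinv : Tendsto (fun n : ℕ => 1 / ((k + n : ℕ) : ℝ)) atTop (𝓝 0) := by
    refine tendsto_one_div_atTop_nhds_zero_nat.comp ?_
    exact tendsto_atTop_mono (fun n => Nat.le_add_left n k) tendsto_id
  have hratio : Tendsto (fun n : ℕ => 1 - k * (1 / ((k + n : ℕ) : ℝ))) atTop (𝓝 (1 - k * 0)) :=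
    (hinv.const_mul _).const_sub _
  -- The new average is `a / (k + n)` plus `1 - k / (k + n)` times the old one.
  have h := (hinv.mul_const a).add (hratio.mul hs)
  simp only [zero_mul, mul_zero, sub_zero, one_mul, zero_add] at h
  refine h.congr' ?_
  filter_upwards [eventually_gt_atTop 0] with n hn
  have h1 : (n : ℝ) ≠ 0 := by exact_mod_cast hn.ne'
  have h2 : ((k : ℝ) + n) ≠ 0 := by positivity
  push_cast
  field_simp
  ring

end Limits

/-! ### Samples and bridge estimates along a fixed outcome. -/

namespace Run

variable {d : ℕ} {Ω : Set (Space d)} {ρ : Space d → ℝ} {q : Space d → Space d → ℝ}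
  {n N₀ ℓ : ℕ} {T : ℕ → ℕ} {Ξ : Type*} [mΞ : MeasurableSpace Ξ] {P : Measure Ξ}

section Deterministic

variable (R : Run Ω ρ q n N₀ ℓ T P)

lemma sample_update (t : ℕ) (ω : Ξ) {k : ℕ} (hk : k < ℓ) :
    R.sample (Function.update T ℓ t) k ω = R.sample T k ω := by
  induction k with
  | zero => rfl
  | succ k ih =>
    simp only [sample]
    rw [ih (by omega), Function.update_of_ne (by omega)]

-- The other chains stay in their own cells, which are disjoint from the `i`-th, so they contribute
-- nothing.
open Classical in
lemma filter_stagePoints {k t : ℕ} {ω : Ξ}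
    (hstay : ∀ j, (cell Ω (R.label k ω) j).Nonempty → ∀ s, R.chain k j s ω ∈
      cell Ω (R.label k ω) j) {i : Fin n} (hi : (cell Ω (R.label k ω) i).Nonempty) :
    (R.stagePoints k t ω).filter (fun x => x ∈ cell Ω (R.label k ω) i) =
      (Multiset.range t).map fun s => R.chain k i s ω := by
  unfold stagePoints
  rw [← Finset.add_sum_erase _ _ (Finset.mem_univ i), Multiset.filter_add, if_pos hi,
    Multiset.filter_eq_self.2, Multiset.filter_eq_nil.2, add_zero]
  · intro x hx hxi
    obtain ⟨j, hj, hxj⟩ := Multiset.mem_sum.1 hx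
    split_ifs at hxj with hne
    · obtain ⟨s, -, rfl⟩ := Multiset.mem_map.1 hxj
      exact Finset.ne_of_mem_erase hj ((hstay j hne s).2.symm.trans hxi.2)
    · simp at hxj
  · intro x hx
    obtain ⟨s, -, rfl⟩ := Multiset.mem_map.1 hx
    exact hstay i hi s

open Classical in
/-- The points of a cell are those of the earlier stages and those of its own chain. -/
lemma exists_cellSample_eq (hℓ : 1 ≤ ℓ) {ω : Ξ}
    (hstay : ∀ j, (cell Ω (R.label ℓ ω) j).Nonempty → ∀ s, R.chain ℓ j s ω ∈
      cell Ω (R.label ℓ ω) j) {i : Fin n} (hi : (cell Ω (R.label ℓ ω) i).Nonempty) :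
    ∃ S₀ : Multiset (Space d), ∀ t, R.cellSample (Function.update T ℓ t) i ω =
      S₀ + (Multiset.range t).map fun s => R.chain ℓ i s ω := by
  obtain ⟨m, rfl⟩ : ∃ m, ℓ = m + 1 := ⟨ℓ - 1, by omega⟩
  refine ⟨(R.sample T m ω).filter (fun x => x ∈ cell Ω (R.label (m + 1) ω) i), fun t => ?_⟩
  rw [cellSample, sample, Function.update_self, Multiset.filter_add,
    R.sample_update t ω (Nat.lt_succ_self m), R.filter_stagePoints hstay hi]

/-- The quotient of the limits is `I / (m⁻¹ * I) = m`. The earlier points `S₀` add a fixed sum to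
the denominator and only shift the number of draws in the numerator. -/
lemma tendsto_bridgeEstimate {τ p α : Space d → ℝ} {S₀ : Multiset (Space d)} {X θ : ℕ → Space d}
    {I m : ℝ} (hI : I ≠ 0) (hm : m ≠ 0)
    (hX : Tendsto (fun t : ℕ => 1 / (t : ℝ) * ∑ s ∈ Finset.range t, p (X s) * α (X s)) atTop
      (𝓝 (m⁻¹ * I)))
    (hθ : Tendsto (fun t : ℕ => 1 / (t : ℝ) * ∑ s ∈ Finset.range t, τ (θ s) * α (θ s)) atTop
      (𝓝 I)) :
    Tendsto (fun t : ℕ => bridgeEstimate τ p α (S₀ + (Multiset.range t).map X) θ) atTop (𝓝 m) := by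
  have hcard (t : ℕ) : (S₀ + (Multiset.range t).map X).card = S₀.card + t := by simp
  have hsum (t : ℕ) : ((S₀ + (Multiset.range t).map X).map fun x => p x * α x).sum =
      (S₀.map fun x => p x * α x).sum + ∑ s ∈ Finset.range t, p (X s) * α (X s) := by
    rw [Multiset.map_add, Multiset.sum_add, Multiset.map_map]
    rfl
  unfold bridgeEstimate
  simp_rw [hcard, hsum]
  have hnum := hθ.comp (tendsto_atTop_mono (fun t => Nat.le_add_left t S₀.card) tendsto_id)
  have hden := tendsto_average_add (S₀.map fun x => p x * α x).sum S₀.card hX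
  have h := hnum.div hden (mul_ne_zero (inv_ne_zero hm) hI)
  rwa [div_mul_cancel_right₀ hI, inv_inv] at h

lemma bridgeEstimate_eq_zero {τ p α : Space d → ℝ} (S : Multiset (Space d)) {θ : ℕ → Space d}
    (hθ : ∀ j, τ (θ j) = 0) : bridgeEstimate τ p α S θ = 0 := by
  simp [bridgeEstimate, hθ]

end Deterministic

/-- With `g = 1` it says that the masses add up to `1`; with `g = h` it assembles the limit. -/
lemma sum_setIntegral_cell (H : BoundedDensities Ω ρ q) {lab : Space d → Fin n}
    (hlab : Measurable lab) {g : Space d → ℝ} (hg : IntegrableOn g Ω (targetMeasure Ω ρ)) :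
    ∑ i, ∫ x in cell Ω lab i, g x ∂targetMeasure Ω ρ = ∫ x, g x ∂targetMeasure Ω ρ := by
  have hcell (i : Fin n) : MeasurableSet (cell Ω lab i) :=
    H.measurableSet_space.inter (hlab (measurableSet_singleton i))
  have hunion : ⋃ i, cell Ω lab i = Ω := by
    ext x; simp [cell]
  rw [← integral_iUnion_fintype hcell (fun i j hij => Set.disjoint_left.2 fun x hx hx' =>
    hij (hx.2.symm.trans hx'.2)) fun i => hg.mono_set fun x hx => hx.1, hunion]
  have hΩ : (targetMeasure Ω ρ).restrict Ω = targetMeasure Ω ρ := by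
    rw [targetMeasure, restrict_withDensity H.measurableSet_space,
      Measure.restrict_restrict H.measurableSet_space, Set.inter_self]
  rw [hΩ]

/-! ### The past of the last stage as random parameter. -/

section Past

variable (R : Run Ω ρ q n N₀ ℓ T P)

/-- The sample space with the events that are known before the chains of the last stage run. -/
def Past (_ : Run Ω ρ q n N₀ ℓ T P) : Type _ := Ξ

/-- Using the sample space itself as parameter space makes the partition and the bridge functions
jointly measurable functions of the parameter, without any space of partitions. -/
instance : MeasurableSpace R.Past := R.info ℓ

/-- The point of the sample space, as an element of the coarser measurable space `R.Past`. -/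
def past : Ξ → R.Past := id

/-- The points of the `i`-th element of the last partition, jointly with the past. -/
def lastCell (i : Fin n) : Set (R.Past × Space d) :=
  {z | z.2 ∈ Ω ∧ R.label ℓ z.1 z.2 = i}

lemma measurableSet_lastCell (H : BoundedDensities Ω ρ q) (hℓ : 1 ≤ ℓ) (i : Fin n) :
    MeasurableSet (R.lastCell i) := by
  have h : Measurable fun z : R.Past × Space d => R.label ℓ z.1 z.2 :=
    R.measurable_label ℓ hℓ le_rfl
  exact (measurable_snd H.measurableSet_space).inter (h (measurableSet_singleton i))

lemma measurable_label_apply (hℓ : 1 ≤ ℓ) (ω : Ξ) : Measurable (R.label ℓ ω) := by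
  have h : Measurable fun z : R.Past × Space d => R.label ℓ z.1 z.2 :=
    R.measurable_label ℓ hℓ le_rfl
  exact h.comp (measurable_prodMk_left (x := R.past ω))

/-- The information available when the chains of the last stage have made `t` steps. -/
abbrev chainPast (t : ℕ) : MeasurableSpace Ξ :=
  R.info ℓ ⊔ ⨆ (j : Fin n) (s : ℕ) (_ : s ≤ t),
    MeasurableSpace.comap (R.chain ℓ j s) inferInstance

/-- The information available before the `j`-th draw from the `i`-th proposal density. -/
abbrev drawPast (i : Fin n) (j : ℕ) : MeasurableSpace Ξ :=
  R.info ℓ ⊔ ⨆ (s : ℕ) (_ : s < j), MeasurableSpace.comap (R.draw i s) inferInstance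

lemma chainPast_le (t : ℕ) : R.chainPast t ≤ mΞ :=
  sup_le (R.info_le ℓ) (iSup_le fun j => iSup_le fun s => iSup_le fun _ =>
    (R.measurable_chain ℓ j s).comap_le)

lemma drawPast_le (i : Fin n) (j : ℕ) : R.drawPast i j ≤ mΞ :=
  sup_le (R.info_le ℓ) (iSup_le fun s => iSup_le fun _ => (R.measurable_draw i s).comap_le)

lemma measurable_past_chainPast (t : ℕ) : Measurable[R.chainPast t] R.past :=
  fun _ hs => (le_sup_left : R.info ℓ ≤ R.chainPast t) _ hs

lemma measurable_past_drawPast (i : Fin n) (j : ℕ) : Measurable[R.drawPast i j] R.past :=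
  fun _ hs => (le_sup_left : R.info ℓ ≤ R.drawPast i j) _ hs

lemma measurable_chain_chainPast (i : Fin n) {s t : ℕ} (hst : s ≤ t) :
    Measurable[R.chainPast t] (R.chain ℓ i s) :=
  measurable_iff_comap_le.2 (le_trans (le_iSup_of_le i (le_iSup₂_of_le
    (f := fun s (_ : s ≤ t) => MeasurableSpace.comap (R.chain ℓ i s) inferInstance) s hst le_rfl))
    le_sup_right)

lemma measurable_draw_drawPast (i : Fin n) {s j : ℕ} (hsj : s < j) :
    Measurable[R.drawPast i j] (R.draw i s) :=
  measurable_iff_comap_le.2 (le_trans (le_iSup₂_of_le s hsj le_rfl) le_sup_right)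

lemma ae_chain_step (hℓ : 1 ≤ ℓ) (i : Fin n) (t : ℕ) (A : Set (Space d)) (hA : MeasurableSet A) :
    ∀ᵐ ω ∂P, (R.past ω, R.chain ℓ i t ω) ∈ R.lastCell i →
      (P⟦R.chain ℓ i (t + 1) ⁻¹' A | R.chainPast t⟧) ω =
        (mhStep q ((Prod.mk (R.past ω) ⁻¹' R.lastCell i).indicator ρ) (R.chain ℓ i t ω)).real A :=
  (R.chain_step ℓ i t hℓ le_rfl A hA).mono fun _ h hω => h ⟨_, hω⟩

/-- The chains of the last stage stay in their cells. -/
lemma ae_chain_mem [IsProbabilityMeasure P] (H : BoundedDensities Ω ρ q) (hℓ : 1 ≤ ℓ) :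
    ∀ᵐ ω ∂P, ∀ i, (cell Ω (R.label ℓ ω) i).Nonempty →
      ∀ t, R.chain ℓ i t ω ∈ cell Ω (R.label ℓ ω) i := by
  refine ae_all_iff.2 fun i => ?_
  filter_upwards [ae_forall_mem_of_mhStep H (R.measurableSet_lastCell H hℓ i) (fun z hz => hz.1)
    R.chainPast_le R.measurable_past_chainPast
    (fun s t hst => R.measurable_chain_chainPast i hst) (R.ae_chain_step hℓ i),
    R.chain_zero_mem ℓ i hℓ le_rfl] with ω h1 h2 hne
  exact h1 (h2 hne)

/-- The events of the past on which the `i`-th cell has positive mass and its bridge function is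
integrable. -/
def goodPast (i : Fin n) : Set R.Past :=
  {w | 0 < targetMeasure Ω ρ (Prod.mk w ⁻¹' R.lastCell i) ∧
    Integrable (fun x => R.bridgeProposal i w x * R.bridgeFunction i w x *
      (Prod.mk w ⁻¹' R.lastCell i).indicator ρ x) volume}

lemma measurable_bridgeProposal_past (i : Fin n) :
    Measurable fun z : R.Past × Space d => R.bridgeProposal i z.1 z.2 :=
  R.measurable_bridgeProposal i

lemma measurable_bridgeFunction_past (i : Fin n) :
    Measurable fun z : R.Past × Space d => R.bridgeFunction i z.1 z.2 :=
  R.measurable_bridgeFunction i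

lemma measurable_cellDensity_past (H : BoundedDensities Ω ρ q) (hℓ : 1 ≤ ℓ) (i : Fin n) :
    Measurable fun z : R.Past × Space d => (Prod.mk z.1 ⁻¹' R.lastCell i).indicator ρ z.2 :=
  (H.measurable_target.comp measurable_snd).indicator (R.measurableSet_lastCell H hℓ i)

lemma measurableSet_goodPast (H : BoundedDensities Ω ρ q) (hℓ : 1 ≤ ℓ) (i : Fin n) :
    MeasurableSet (R.goodPast i) := by
  have := H.isProbabilityMeasure_target
  refine MeasurableSet.inter
    (measurableSet_lt measurable_const
      (measurable_measure_prodMk_left (R.measurableSet_lastCell H hℓ i)))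
    (measurableSet_integrable ?_)
  exact (((R.measurable_bridgeProposal_past i).mul (R.measurable_bridgeFunction_past i)).mul
    (R.measurable_cellDensity_past H hℓ i)).stronglyMeasurable

lemma ae_tendsto_chain_average [IsProbabilityMeasure P] (H : BoundedDensities Ω ρ q) (hℓ : 1 ≤ ℓ) (i : Fin n)
    {f : R.Past × Space d → ℝ} (hf : Measurable f)
    (hfi : ∀ w ∈ R.goodPast i, IntegrableOn (fun x => f (w, x)) (Prod.mk w ⁻¹' R.lastCell i)
      (targetMeasure Ω ρ)) :
    ∀ᵐ ω ∂P, R.past ω ∈ R.goodPast i → Tendsto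
      (fun t : ℕ => 1 / (t : ℝ) * ∑ s ∈ Finset.range t, f (R.past ω, R.chain ℓ i s ω)) atTop
      (𝓝 (((targetMeasure Ω ρ).real (cell Ω (R.label ℓ ω) i))⁻¹ *
        ∫ x in cell Ω (R.label ℓ ω) i, f (R.past ω, x) ∂targetMeasure Ω ρ)) := by
  refine ae_tendsto_average_of_mhStep H (R.measurableSet_lastCell H hℓ i) (fun z hz => hz.1)
    R.chainPast_le R.measurable_past_chainPast
    (fun s t hst => R.measurable_chain_chainPast i hst) (R.ae_chain_step hℓ i)
    (R.measurableSet_goodPast H hℓ i) (fun w hw => hw.1) ?_ hf hfi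
  filter_upwards [R.chain_zero_mem ℓ i hℓ le_rfl] with ω h1 h2
  exact h1 (nonempty_of_measure_ne_zero h2.1.ne')

lemma integrableOn_bridge (H : BoundedDensities Ω ρ q) (hℓ : 1 ≤ ℓ) (i : Fin n) {w : R.Past}
    (hw : w ∈ R.goodPast i) :
    IntegrableOn (fun x => R.bridgeProposal i w x * R.bridgeFunction i w x)
      (Prod.mk w ⁻¹' R.lastCell i) (targetMeasure Ω ρ) := by
  have hD : MeasurableSet (Prod.mk w ⁻¹' R.lastCell i) :=
    measurable_prodMk_left (R.measurableSet_lastCell H hℓ i)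
  have hDΩ : Prod.mk w ⁻¹' R.lastCell i ⊆ Ω := fun x hx => hx.1
  rw [IntegrableOn, targetMeasure_restrict hD hDΩ]
  refine integrable_densityMeasure (H.measurable_target.indicator hD)
    (indicator_target_nonneg H hDΩ) (hw.2.congr (ae_of_all _ fun x => ?_))
  simp only
  ring

/-- The chain and the draws lead to the same integral, up to the mass of the cell; this is why the
bridge quotient recovers the mass. -/
lemma setIntegral_bridge (H : BoundedDensities Ω ρ q) (hℓ : 1 ≤ ℓ) (i : Fin n) (ω : Ξ) :
    ∫ x in cell Ω (R.label ℓ ω) i, R.bridgeProposal i ω x * R.bridgeFunction i ω x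
        ∂targetMeasure Ω ρ =
      ∫ x, R.bridgeProposal i ω x * R.bridgeFunction i ω x *
        cellDensity Ω ρ (R.label ℓ ω) i x := by
  have hD : MeasurableSet (cell Ω (R.label ℓ ω) i) :=
    measurable_prodMk_left (x := R.past ω) (R.measurableSet_lastCell H hℓ i)
  have hDΩ : cell Ω (R.label ℓ ω) i ⊆ Ω := fun x hx => hx.1
  rw [targetMeasure_restrict hD hDΩ, integral_densityMeasure (H.measurable_target.indicator hD)
    (indicator_target_nonneg H hDΩ)]
  refine integral_congr_ae (ae_of_all _ fun x => ?_)
  simp only [cellDensity]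
  ring

lemma ae_tendsto_draw_average [IsProbabilityMeasure P] (H : BoundedDensities Ω ρ q) (hℓ : 1 ≤ ℓ) (i : Fin n) :
    ∀ᵐ ω ∂P, R.past ω ∈ R.goodPast i → Tendsto
      (fun t : ℕ => 1 / (t : ℝ) * ∑ s ∈ Finset.range t,
        cellDensity Ω ρ (R.label ℓ ω) i (R.draw i s ω) * R.bridgeFunction i ω (R.draw i s ω))
      atTop (𝓝 (∫ x, R.bridgeProposal i ω x * R.bridgeFunction i ω x *
        cellDensity Ω ρ (R.label ℓ ω) i x)) := by
  have hp := R.measurable_bridgeProposal_past i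
  have hpw (w : R.Past) : Measurable (R.bridgeProposal i w) := hp.comp measurable_prodMk_left
  have h := ae_tendsto_average_of_draws (P := P) (p := fun w : R.Past => R.bridgeProposal i w) hp
    -- The index is shifted because `drawPast i j` contains only the draws before `j`; the law of
    -- the first draw is irrelevant to the limit.
    (R.isProbabilityMeasure_bridgeProposal i) (ℱ := fun j => R.drawPast i (j + 1))
    (fun j => R.drawPast_le i (j + 1)) (fun j => R.measurable_past_drawPast i (j + 1))
    (X := R.draw i) (fun s j hsj => R.measurable_draw_drawPast i (by omega))
    (fun j A hA => R.draw_law i (j + 1) A hA) (R.measurableSet_goodPast H hℓ i)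
    (f := fun z => (Prod.mk z.1 ⁻¹' R.lastCell i).indicator ρ z.2 * R.bridgeFunction i z.1 z.2)
    ((R.measurable_cellDensity_past H hℓ i).mul (R.measurable_bridgeFunction_past i))
    (fun w hw => integrable_densityMeasure (hpw w) (R.bridgeProposal_nonneg i w)
      (hw.2.congr (ae_of_all _ fun x => by simp only; ring)))
  filter_upwards [h] with ω h1 h2
  have h3 := integral_densityMeasure (hpw (R.past ω)) (R.bridgeProposal_nonneg i ω)
    fun x => cellDensity Ω ρ (R.label ℓ ω) i x * R.bridgeFunction i ω x
  have h4 : ∫ x, R.bridgeProposal i ω x * R.bridgeFunction i ω x *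
      cellDensity Ω ρ (R.label ℓ ω) i x =
      ∫ x, R.bridgeProposal i ω x * (cellDensity Ω ρ (R.label ℓ ω) i x *
        R.bridgeFunction i ω x) :=
    integral_congr_ae (ae_of_all _ fun x => by ring)
  rw [h4]
  exact (congrArg 𝓝 h3) ▸ h1 h2

/-- The draws almost surely avoid a null cell. -/
lemma ae_draw_notMem [IsProbabilityMeasure P] (H : BoundedDensities Ω ρ q) (hℓ : 1 ≤ ℓ) (i : Fin n) :
    ∀ᵐ ω ∂P, targetMeasure Ω ρ (cell Ω (R.label ℓ ω) i) = 0 →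
      ∀ j, R.draw i j ω ∉ cell Ω (R.label ℓ ω) i := by
  have := H.isProbabilityMeasure_target
  have hcell := R.measurableSet_lastCell H hℓ i
  have hnull : MeasurableSet {w : R.Past | targetMeasure Ω ρ (Prod.mk w ⁻¹' R.lastCell i) = 0} :=
    (measurable_measure_prodMk_left hcell) (measurableSet_singleton 0)
  -- Keeping only the pasts with a null cell makes every section of `N` Lebesgue null: it is either
  -- a null cell or empty.
  have h (j : ℕ) := ae_notMem_of_draw (P := P) (p := fun w : R.Past => R.bridgeProposal i w)
    (R.measurable_bridgeProposal_past i) (R.isProbabilityMeasure_bridgeProposal i)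
    (R.drawPast_le i j) (R.measurable_past_drawPast i j) (R.measurable_draw i j)
    (fun A hA => R.draw_law i j A hA) (N := R.lastCell i ∩ Prod.fst ⁻¹'
      {w : R.Past | targetMeasure Ω ρ (Prod.mk w ⁻¹' R.lastCell i) = 0})
    (hcell.inter (measurable_fst hnull)) fun w => by
      by_cases hw : targetMeasure Ω ρ (Prod.mk w ⁻¹' R.lastCell i) = 0
      · exact measure_mono_null (fun x hx => hx.1) (volume_eq_zero_of_targetMeasure H
          (measurable_prodMk_left hcell) (fun x hx => hx.1) hw)
      · refine measure_mono_null (fun x hx => ?_) measure_empty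
        exact hw hx.2
  filter_upwards [ae_all_iff.2 h] with ω h1 h2 j h3
  exact h1 j ⟨h3, h2⟩

end Past

end Run

/-! ### Almost sure limits of the raw weights and of the chain averages. -/

namespace Run

variable {d : ℕ} {Ω : Set (Space d)} {ρ : Space d → ℝ} {q : Space d → Space d → ℝ}
  {n N₀ ℓ : ℕ} {T : ℕ → ℕ} {Ξ : Type*} [mΞ : MeasurableSpace Ξ] {P : Measure Ξ}
  (R : Run Ω ρ q n N₀ ℓ T P)

/-- The bridge-sampling estimates converge to the masses of the cells, and vanish for null cells. -/
lemma ae_tendsto_rawWeight [IsProbabilityMeasure P] (H : BoundedDensities Ω ρ q) (hℓ : 1 ≤ ℓ)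
    (i : Fin n)
    (hbridge : ∀ᵐ ω ∂P, 0 < targetMeasure Ω ρ (cell Ω (R.label ℓ ω) i) →
      Integrable (fun x => R.bridgeProposal i ω x * R.bridgeFunction i ω x *
        cellDensity Ω ρ (R.label ℓ ω) i x) volume ∧
      ∫ x, R.bridgeProposal i ω x * R.bridgeFunction i ω x *
        cellDensity Ω ρ (R.label ℓ ω) i x ≠ 0) :
    ∀ᵐ ω ∂P,
      (0 < targetMeasure Ω ρ (cell Ω (R.label ℓ ω) i) →
        Tendsto (fun t => R.rawWeight (Function.update T ℓ t) i ω) atTop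
          (𝓝 ((targetMeasure Ω ρ).real (cell Ω (R.label ℓ ω) i)))) ∧
      (targetMeasure Ω ρ (cell Ω (R.label ℓ ω) i) = 0 →
        ∀ T', R.rawWeight T' i ω = 0) := by
  have := H.isProbabilityMeasure_target
  filter_upwards [hbridge, R.ae_chain_mem H hℓ, R.ae_tendsto_draw_average H hℓ i,
    R.ae_draw_notMem H hℓ i, R.ae_tendsto_chain_average H hℓ i
      (f := fun z => R.bridgeProposal i z.1 z.2 * R.bridgeFunction i z.1 z.2)
      ((R.measurable_bridgeProposal_past i).mul (R.measurable_bridgeFunction_past i))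
      (fun w hw => R.integrableOn_bridge H hℓ i hw)] with ω hb hstay hdraw hnull hchain
  refine ⟨fun hpos => ?_, fun h0 T' => ?_⟩
  · obtain ⟨hbi, hb0⟩ := hb hpos
    have hgood : R.past ω ∈ R.goodPast i := ⟨hpos, hbi⟩
    obtain ⟨S₀, hS₀⟩ := R.exists_cellSample_eq hℓ hstay
      (nonempty_of_measure_ne_zero hpos.ne')
    have hc := hchain hgood
    simp only [past, id] at hc
    rw [R.setIntegral_bridge H hℓ i ω] at hc
    unfold rawWeight
    simp_rw [hS₀]
    exact tendsto_bridgeEstimate hb0 (ENNReal.toReal_pos hpos.ne' (measure_ne_top _ _)).ne' hc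
      (hdraw hgood)
  · exact bridgeEstimate_eq_zero _ fun j => Set.indicator_of_notMem (hnull h0 j) _

lemma ae_tendsto_chainMean [IsProbabilityMeasure P] (H : BoundedDensities Ω ρ q) (hℓ : 1 ≤ ℓ)
    {h : Space d → ℝ} (hmeas : Measurable h) (hint : IntegrableOn h Ω (targetMeasure Ω ρ))
    (i : Fin n) :
    ∀ᵐ ω ∂P, R.past ω ∈ R.goodPast i →
      Tendsto (fun t => R.chainMean h (Function.update T ℓ t) i ω) atTop
        (𝓝 (((targetMeasure Ω ρ).real (cell Ω (R.label ℓ ω) i))⁻¹ *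
          ∫ x in cell Ω (R.label ℓ ω) i, h x ∂targetMeasure Ω ρ)) := by
  filter_upwards [R.ae_tendsto_chain_average H hℓ i (f := fun z => h z.2)
    (hmeas.comp measurable_snd) (fun w _ => hint.mono_set fun x hx => hx.1)] with ω h1 h2
  unfold chainMean
  simp_rw [Function.update_self]
  exact h1 h2

end Run

end ParallelMCMC

end

theorem mainTheorem1 {d : ℕ} (Ω : Set (ParallelMCMC.Space d)) (ρ : ParallelMCMC.Space d → ℝ)
    (q : ParallelMCMC.Space d → ParallelMCMC.Space d → ℝ)
    (hdens : ParallelMCMC.BoundedDensities Ω ρ q)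
    (h : ParallelMCMC.Space d → ℝ) (hmeas : Measurable h)
    (hbdd : ∃ M : ℝ, ∀ x ∈ Ω, |h x| ≤ M)
    (n N₀ ℓ : ℕ) (hℓ : 1 ≤ ℓ) (T : ℕ → ℕ)
    {Ξ : Type*} [MeasurableSpace Ξ] (P : Measure Ξ) [IsProbabilityMeasure P]
    (R : ParallelMCMC.Run Ω ρ q n N₀ ℓ T P)
    (hbridge : ∀ i : Fin n, ∀ᵐ ω ∂P,
      0 < ParallelMCMC.targetMeasure Ω ρ (ParallelMCMC.cell Ω (R.label ℓ ω) i) →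
        Integrable (fun x => R.bridgeProposal i ω x * R.bridgeFunction i ω x *
          ParallelMCMC.cellDensity Ω ρ (R.label ℓ ω) i x) volume ∧
        ∫ x, R.bridgeProposal i ω x * R.bridgeFunction i ω x *
          ParallelMCMC.cellDensity Ω ρ (R.label ℓ ω) i x ≠ 0) :
    ∀ᵐ ω ∂P, Tendsto (fun t : ℕ => R.estimate h (Function.update T ℓ t) ω) atTop
      (𝓝 (∫ x, h x ∂(ParallelMCMC.targetMeasure Ω ρ))) := by
  have := hdens.isProbabilityMeasure_target
  have hint : IntegrableOn h Ω (ParallelMCMC.targetMeasure Ω ρ) := by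
    obtain ⟨M, hM⟩ := hbdd
    exact Integrable.of_bound hmeas.aestronglyMeasurable M
      ((ae_restrict_iff' hdens.measurableSet_space).2 (ae_of_all _ hM))
  filter_upwards [ae_all_iff.2 hbridge,
    ae_all_iff.2 fun i => R.ae_tendsto_rawWeight hdens hℓ i (hbridge i),
    ae_all_iff.2 fun i => R.ae_tendsto_chainMean hdens hℓ hmeas hint i] with ω hb hraw hmean
  have hlab := R.measurable_label_apply hℓ ω
  set m : Fin n → ℝ := fun i =>
    (ParallelMCMC.targetMeasure Ω ρ).real (ParallelMCMC.cell Ω (R.label ℓ ω) i) with hm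
  have hraw' (i : Fin n) :
      Tendsto (fun t => R.rawWeight (Function.update T ℓ t) i ω) atTop (𝓝 (m i)) := by
    rcases eq_zero_or_pos (a := ParallelMCMC.targetMeasure Ω ρ
      (ParallelMCMC.cell Ω (R.label ℓ ω) i)) with h0 | hpos
    · have hmi : m i = 0 := by simp [hm, measureReal_def, h0]
      simp_rw [(hraw i).2 h0, hmi]
      exact tendsto_const_nhds
    · exact (hraw i).1 hpos
  have hsum : ∑ i, m i = 1 := by
    have h1 := ParallelMCMC.Run.sum_setIntegral_cell hdens hlab (g := fun _ => (1 : ℝ))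
      (integrable_const 1).integrableOn
    simpa using h1
  have hweight (i : Fin n) :
      Tendsto (fun t => R.weight (Function.update T ℓ t) i ω) atTop (𝓝 (m i)) := by
    have h1 := (hraw' i).div (tendsto_finsetSum Finset.univ fun j _ => hraw' j)
      (by rw [hsum]; exact one_ne_zero)
    rwa [hsum, div_one] at h1
  rw [← ParallelMCMC.Run.sum_setIntegral_cell hdens hlab hint]
  refine tendsto_finsetSum _ fun i _ => ?_
  -- In a null cell the chain average need not converge, but its weight is exactly `0` for every
  -- chain length. In the other cells the mass in the weight cancels the normalization of the chain
  -- average.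
  rcases eq_zero_or_pos (a := ParallelMCMC.targetMeasure Ω ρ
    (ParallelMCMC.cell Ω (R.label ℓ ω) i)) with h0 | hpos
  · rw [setIntegral_measure_zero _ h0]
    simp_rw [ParallelMCMC.Run.weight, (hraw i).2 h0, zero_div, mul_zero]
    exact tendsto_const_nhds
  · have hmi : m i ≠ 0 := (ENNReal.toReal_pos hpos.ne' (measure_ne_top _ _)).ne'
    have h1 := (hmean i ⟨hpos, (hb i hpos).1⟩).mul (hweight i)
    rwa [mul_right_comm, inv_mul_cancel₀ hmi, one_mul] at h1
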